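/- **Setting.** Let $\mathcal H$ be a separable real or complex Hilbert space and let $\mathfrak L:\mathrm{Dom}(\mathfrak L)\subset\mathcal H\to\mathcal H$ be a densely defined linear operator which is positive, i.e. $(\mathfrak Lf,f)$ is real and $\ge 0$ for all $f\in\mathrm{Dom}(\mathfrak L)$. Assume that there is an orthonormal basis $\{e_\zeta\}_{\zeta\in I}$ of $\mathcal H$ of eigenvectors, $\mathfrak Le_\zeta=\gamma_\zeta e_\zeta$, and that the spectrum of $\mathfrak L$ is $\sigma(\mathfrak L)=\{\gamma_\zeta:\zeta\in I\}$ (the spectrum is the complement of the set of $z$ for which $\mathfrak L-z:\mathrm{Dom}(\mathfrak L)\to\mathcal H$ is bijective with bounded inverse). Let $\mathcal H^\infty_{\mathfrak L}=\bigcap_{k}\mathrm{Dom}(\mathfrak L^k)$ with the Fréchet topology of the seminorms $\max_{j\le k}\|\mathfrak L^j\phi\|$, and let $\mathcal H^{-\infty}_{\mathfrak L}$ be the space of continuous conjugate-linear functionals on it; $\mathcal H$ embeds into it by $f\mapsto(\phi\mapsto (f,\phi))$, where $(\cdot,\cdot)$ is linear in its first argument. For $u\in\mathcal H^{-\infty}_{\mathfrak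 L}$ put $(u,e_\zeta)=u(e_\zeta)$ and $(\mathfrak Lu)(\phi)=u(\mathfrak L\phi)$. For $\delta\in\mathbb R$ let $$\mathcal H^\delta_{\mathfrak L}=\{u\in\mathcal H^{-\infty}_{\mathfrak L}:(I+\mathfrak L)^{\delta/2}u\in\mathcal H\},\qquad \|u\|_{\mathcal H^\delta_{\mathfrak L}}=\Big(\sum_{\zeta\in I}(1+\gamma_\zeta)^\delta|(u,e_\zeta)|^2\Big)^{1/2}.$$ Let $0<\beta\le 1$ and $E_\beta(z)=\sum_{k\ge0}z^k/\Gamma(\beta k+1)$. Let $X$ be $\mathcal H$, or one of the spaces $\mathcal H^\delta_{\mathfrak L}$; in the latter case $\mathfrak L$ is taken with domain $\{u\in \mathcal H^\delta_{\mathfrak L}:\mathfrak Lu\in \mathcal H^\delta_{\mathfrak L}\}$. A *continuous solution in $X$* of $$\partial^\beta w(t)+\mathfrak Lw(t)=0\quad(t>0),\qquad w(0)=w_0\in X, \tag{1}$$ is a function $w\in C([0,\infty),X)$ with $w(0)=w_0$ such that for every $t>0$ the value $w(t)$ lies in the domain of $\mathfrak L$ in $X$, and the Caputo derivative $\partial^\beta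 w(t)=\frac{d}{dt}I^{1-\beta}(w-w(0))(t)$ exists in $X$ and equals $-\mathfrak Lw(t)$. Here $I^{\alpha}f(t)=\Gamma(\alpha)^{-1}\int_0^t(t-s)^{\alpha-1}f(s)\,ds$ for $\alpha>0$ and $I^0f=f$. **Theorem.** Let $0<\beta\le1$ and $\delta\in\mathbb R$. (0) For all $t\ge0$ and $\zeta\in I$, $E_\beta(-t^\beta\mathfrak L)e_\zeta:=\sum_{k\ge0}\frac{(-t^\beta\mathfrak L)^k}{\Gamma(\beta k+1)}e_\zeta$ converges in $\mathcal H$ and equals $E_\beta(-\gamma_\zeta t^\beta)e_\zeta$. For every $w_0\in\mathcal H$ the problem (1) has a unique continuous solution in $\mathcal H$, and for all $t\ge 0$ $$w(t)=\sum_{\zeta\in I}(w_0,e_\zeta)\,E_\beta(-\gamma_\zeta t^\beta)\,e_\zeta \tag{2}$$ with convergence in $\mathcal H$. In (i)–(iii) the constant $C>0$ depends on neither $w_0$ nor $t$, and uniqueness holds in the whole scale: every continuous solution in any $\mathcal H^\sigma_{\mathfrak L}$, $\sigma\in\mathbb R$, with initial value $w_0$ coincides with $w$ on $[0,\infty)$.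 (i) For every $w_0\in\mathcal H^\delta_{\mathfrak L}$ there is a unique continuous solution $w$ of (1) in $\mathcal H^\delta_{\mathfrak L}$. It is given by (2), with convergence in $\mathcal H^\delta_{\mathfrak L}$ for all $t\ge0$, and $$\|w(t)\|_{\mathcal H^\delta_{\mathfrak L}}\le C\|w_0\|_{\mathcal H^\delta_{\mathfrak L}},\qquad t\ge0.$$ (ii) If $0\notin\sigma(\mathfrak L)$, the solution in (i) satisfies $$\|w(t)\|_{\mathcal H^\delta_{\mathfrak L}}\le C(1+t^\beta)^{-1}\|w_0\|_{\mathcal H^\delta_{\mathfrak L}},\qquad t\ge0.$$ (iii) For every $w_0\in\mathcal H^{\delta-2}_{\mathfrak L}$ there is a unique continuous solution $w$ of (1) in $\mathcal H^{\delta-2}_{\mathfrak L}$, given by (2) with convergence in $\mathcal H^{\delta-2}_{\mathfrak L}$ for all $t\ge0$. For $t>0$ one has $w(t)\in\mathcal H^\delta_{\mathfrak L}$, $w$ is continuous from $(0,\infty)$ into $\mathcal H^\delta_{\mathfrak L}$, the series (2) converges in $\mathcal H^\delta_{\mathfrak L}$, and $$\|w(t)\|_{\mathcal H^\delta_{\mathfrak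 L}}\le C(1+t^{-\beta})\|w_0\|_{\mathcal H^{\delta-2}_{\mathfrak L}},\qquad t>0.$$ -/

import Mathlib

open Filter Topology MeasureTheory

noncomputable section

/-! ### Fractional calculus for functions with values in a Banach space -/

/-- The two-parametric Mittag-Leffler function `E_{ν,ρ}(x) = ∑ₖ xᵏ / Γ(νk + ρ)` on the real line. -/
def mittagLeffler (ν ρ x : ℝ) : ℝ := ∑' k : ℕ, x ^ k / Real.Gamma (ν * k + ρ)

/-- The Riemann-Liouville integral of order `α ≥ 0` with base point `0`:
`(I^α f)(t) = Γ(α)⁻¹ ∫₀ᵗ (t - s)^(α-1) f(s) ds` for `α > 0`, and `I⁰ f = f`. -/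
def rlIntegral {X : Type*} [NormedAddCommGroup X] [NormedSpace ℝ X]
    (α : ℝ) (f : ℝ → X) (t : ℝ) : X :=
  if α = 0 then f t
  else (Real.Gamma α)⁻¹ • ∫ s in (0 : ℝ)..t, (t - s) ^ (α - 1) • f s

/-- `v` is the value at `t` of the Dzhrbashyan-Caputo derivative of order `0 < β ≤ 1` of `w`, i.e.
of the Riemann-Liouville derivative `d/dt I^(1-β)` of `w - w(0)`. For `β = 1` it is `w'(t)`. -/
def HasCaputoDerivAt {X : Type*} [NormedAddCommGroup X] [NormedSpace ℝ X]
    (β : ℝ) (w : ℝ → X) (v : X) (t : ℝ) : Prop :=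
  HasDerivAt (rlIntegral (1 - β) fun s => w s - w 0) v t

/-- `w : [0, ∞) → X` is a continuous solution of `∂^β w + A w = 0` for `t > 0`, `w(0) = w₀`, in the
Banach space `X`: it is continuous on `[0, ∞)`, and for each `t > 0` the value `w(t)` lies in the
domain of `A` and the Caputo derivative of `w` at `t` exists in `X` and equals `-A w(t)`.
(The values of `w` at negative times play no role.) -/
structure IsHeatSolution {𝕜 X : Type*} [RCLike 𝕜] [NormedAddCommGroup X] [NormedSpace 𝕜 X]
    (A : X →ₗ.[𝕜] X) (β : ℝ) (w₀ : X) (w : ℝ → X) : Prop where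
  continuousOn : ContinuousOn w (Set.Ici 0)
  initial : w 0 = w₀
  equation : ∀ t : ℝ, 0 < t → ∃ h : w t ∈ A.domain,
    letI : NormedSpace ℝ X := NormedSpace.restrictScalars ℝ 𝕜 X
    HasCaputoDerivAt β w (-(A ⟨w t, h⟩)) t

/-! ### Unbounded operators -/

/-- The spectrum of an unbounded operator: the complement of the set of those `z` for which
`A - z` is a bijection from the domain of `A` onto `H` with a bounded inverse `R`. -/
def unboundedSpectrum {𝕜 H : Type*} [RCLike 𝕜] [NormedAddCommGroup H] [NormedSpace 𝕜 H]
    (A : H →ₗ.[𝕜] H) : Set 𝕜 :=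
  {z | ¬ ∃ R : H →L[𝕜] H,
    (∀ f : H, ∃ h : R f ∈ A.domain, A ⟨R f, h⟩ - z • R f = f) ∧
    ∀ g : A.domain, R (A g - z • (g : H)) = g}

/-- A densely defined positive operator `L` on `H` with discrete spectrum `{γ ζ : ζ ∈ ι}`, together
with an orthonormal basis `e` of `H` consisting of eigenvectors of `L`, `L (e ζ) = γ ζ • e ζ`. -/
structure PositiveDiscreteOperator (𝕜 H ι : Type*) [RCLike 𝕜] [NormedAddCommGroup H]
    [InnerProductSpace 𝕜 H] where
  /-- the operator -/
  L : H →ₗ.[𝕜] H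
  dense_domain : Dense (L.domain : Set H)
  positive : ∀ f : L.domain,
    0 ≤ RCLike.re (inner 𝕜 (f : H) (L f)) ∧ RCLike.im (inner 𝕜 (f : H) (L f)) = 0
  /-- the orthonormal basis of eigenvectors -/
  e : HilbertBasis ι 𝕜 H
  /-- the eigenvalues -/
  γ : ι → ℝ
  e_mem : ∀ ζ, e ζ ∈ L.domain
  eigen : ∀ ζ, L ⟨e ζ, e_mem ζ⟩ = (γ ζ : 𝕜) • e ζ
  spectrum_eq : unboundedSpectrum L = Set.range fun ζ => (γ ζ : 𝕜)

namespace PositiveDiscreteOperator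

variable {𝕜 H ι : Type*} [RCLike 𝕜] [NormedAddCommGroup H] [InnerProductSpace 𝕜 H]
variable (S : PositiveDiscreteOperator 𝕜 H ι)

lemma gamma_nonneg (ζ : ι) : 0 ≤ S.γ ζ := by
  have h := (S.positive ⟨S.e ζ, S.e_mem ζ⟩).1
  rw [S.eigen, inner_smul_right, inner_self_eq_norm_sq_to_K, S.e.orthonormal.1 ζ] at h
  simpa using h

lemma one_add_gamma_pos (ζ : ι) : 0 < 1 + S.γ ζ := by
  have := S.gamma_nonneg ζ
  linarith

/-! ### Test vectors -/

/-- The domain of the iterate `L^k`: `g ∈ Dom(L^(k+1))` iff `g ∈ Dom(L)` and `L g ∈ Dom(L^k)`. -/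
def domPow : ℕ → Submodule 𝕜 H
  | 0 => ⊤
  | k + 1 => ((domPow k).comap S.L.toFun).map S.L.domain.subtype

lemma mem_domPow_succ {k : ℕ} {g : H} :
    g ∈ S.domPow (k + 1) ↔ ∃ h : g ∈ S.L.domain, S.L ⟨g, h⟩ ∈ S.domPow k := by
  constructor
  · rintro ⟨x, hx, rfl⟩
    exact ⟨x.2, hx⟩
  · rintro ⟨h, hg⟩
    exact ⟨⟨g, h⟩, hg, rfl⟩

/-- The space of test vectors `H^∞ = ⋂ₖ Dom(L^k)`. -/
def testSpace : Submodule 𝕜 H := ⨅ k, S.domPow k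

lemma testSpace_le_domain : S.testSpace ≤ S.L.domain := fun g hg => by
  have h : g ∈ S.domPow 1 := (Submodule.mem_iInf _).1 hg 1
  exact (S.mem_domPow_succ.1 h).1

lemma apply_mem_testSpace (g : S.testSpace) :
    S.L ⟨g, S.testSpace_le_domain g.2⟩ ∈ S.testSpace := by
  refine (Submodule.mem_iInf _).2 fun k => ?_
  have h : (g : H) ∈ S.domPow (k + 1) := (Submodule.mem_iInf _).1 g.2 (k + 1)
  exact (S.mem_domPow_succ.1 h).2

/-- The operator `L` on test vectors. -/
def testOp : S.testSpace →ₗ[𝕜] S.testSpace :=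
  (S.L.toFun ∘ₗ Submodule.inclusion S.testSpace_le_domain).codRestrict S.testSpace
    S.apply_mem_testSpace

lemma coe_testOp (φ : S.testSpace) :
    (S.testOp φ : H) = S.L ⟨φ, S.testSpace_le_domain φ.2⟩ := rfl

/-- The seminorms `max_{j ≤ k} ‖L^j φ‖` which define the Fréchet topology of `H^∞`. -/
def testSeminorm (k : ℕ) (φ : S.testSpace) : ℝ :=
  ((Finset.range (k + 1)).sup fun j => ‖(((S.testOp ^ j) φ : S.testSpace) : H)‖₊ : NNReal)

lemma norm_pow_le_testSeminorm {j k : ℕ} (h : j ≤ k) (φ : S.testSpace) :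
    ‖(((S.testOp ^ j) φ : S.testSpace) : H)‖ ≤ S.testSeminorm k φ := by
  have := Finset.le_sup (f := fun j => ‖(((S.testOp ^ j) φ : S.testSpace) : H)‖₊)
    (Finset.mem_range.2 (Nat.lt_succ_of_le h))
  exact_mod_cast this

lemma testSeminorm_le {k : ℕ} {φ : S.testSpace} {c : ℝ} (hc : 0 ≤ c)
    (h : ∀ j ≤ k, ‖(((S.testOp ^ j) φ : S.testSpace) : H)‖ ≤ c) : S.testSeminorm k φ ≤ c := by
  lift c to NNReal using hc
  refine NNReal.coe_le_coe.2 (Finset.sup_le fun j hj => ?_)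
  exact_mod_cast h j (Nat.lt_succ_iff.1 (Finset.mem_range.1 hj))

lemma testSeminorm_nonneg (k : ℕ) (φ : S.testSpace) : 0 ≤ S.testSeminorm k φ := NNReal.coe_nonneg _

lemma testSeminorm_mono {k l : ℕ} (h : k ≤ l) (φ : S.testSpace) :
    S.testSeminorm k φ ≤ S.testSeminorm l φ :=
  S.testSeminorm_le (S.testSeminorm_nonneg l φ) fun _ hj =>
    S.norm_pow_le_testSeminorm (hj.trans h) φ

lemma testSeminorm_testOp_le (k : ℕ) (φ : S.testSpace) :
    S.testSeminorm k (S.testOp φ) ≤ S.testSeminorm (k + 1) φ :=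
  S.testSeminorm_le (S.testSeminorm_nonneg _ φ) fun j hj => by
    have := S.norm_pow_le_testSeminorm (Nat.succ_le_succ hj) φ
    rwa [pow_succ] at this

lemma e_mem_testSpace (ζ : ι) : S.e ζ ∈ S.testSpace := by
  refine (Submodule.mem_iInf _).2 fun k => ?_
  induction k with
  | zero => exact Submodule.mem_top
  | succ k ih =>
    refine S.mem_domPow_succ.2 ⟨S.e_mem ζ, ?_⟩
    rw [S.eigen]
    exact Submodule.smul_mem _ _ ih

/-- The eigenvector `e ζ` as a test vector. -/
def eTest (ζ : ι) : S.testSpace := ⟨S.e ζ, S.e_mem_testSpace ζ⟩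

lemma testOp_eTest (ζ : ι) : S.testOp (S.eTest ζ) = (S.γ ζ : 𝕜) • S.eTest ζ :=
  Subtype.ext (S.eigen ζ)

lemma testOp_pow_eTest (j : ℕ) (ζ : ι) :
    (S.testOp ^ j) (S.eTest ζ) = ((S.γ ζ : 𝕜) ^ j) • S.eTest ζ := by
  induction j with
  | zero => simp
  | succ j ih => rw [pow_succ', Module.End.mul_apply, ih, map_smul, testOp_eTest, smul_smul, pow_succ]

/-! ### Generalised vectors and the Sobolev scale -/

/-- The continuous conjugate-linear functionals on the Fréchet space `H^∞`. -/
def testDual : Submodule 𝕜 (S.testSpace →ₗ⋆[𝕜] 𝕜) where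
  carrier := {u | ∃ (k : ℕ) (C : ℝ), ∀ φ, ‖u φ‖ ≤ C * S.testSeminorm k φ}
  zero_mem' := ⟨0, 0, fun φ => by simp⟩
  add_mem' := by
    rintro u v ⟨k, C, hu⟩ ⟨l, D, hv⟩
    refine ⟨max k l, |C| + |D|, fun φ => ?_⟩
    have h1 := S.testSeminorm_mono (le_max_left k l) φ
    have h2 := S.testSeminorm_mono (le_max_right k l) φ
    have h3 := S.testSeminorm_nonneg k φ
    have h4 := S.testSeminorm_nonneg l φ
    calc ‖(u + v) φ‖ ≤ ‖u φ‖ + ‖v φ‖ := norm_add_le _ _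
      _ ≤ C * S.testSeminorm k φ + D * S.testSeminorm l φ := add_le_add (hu φ) (hv φ)
      _ ≤ |C| * S.testSeminorm (max k l) φ + |D| * S.testSeminorm (max k l) φ :=
        add_le_add (mul_le_mul (le_abs_self C) h1 h3 (abs_nonneg C))
          (mul_le_mul (le_abs_self D) h2 h4 (abs_nonneg D))
      _ = _ := by ring
  smul_mem' := by
    rintro c u ⟨k, C, hu⟩
    refine ⟨k, ‖c‖ * C, fun φ => ?_⟩
    calc ‖(c • u) φ‖ = ‖c‖ * ‖u φ‖ := norm_mul _ _
      _ ≤ ‖c‖ * (C * S.testSeminorm k φ) := mul_le_mul_of_nonneg_left (hu φ) (norm_nonneg c)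
      _ = _ := by ring

/-- The space `H^{-∞}` of generalised vectors: the continuous conjugate-linear functionals on the
Fréchet space `H^∞`. -/
def GenVec : Type _ := S.testDual

instance : AddCommGroup S.GenVec := inferInstanceAs (AddCommGroup S.testDual)

instance : Module 𝕜 S.GenVec := inferInstanceAs (Module 𝕜 S.testDual)

/-- A vector `f ∈ H` as a generalised vector `φ ↦ ⟪φ, f⟫` (Mathlib's inner product is
conjugate-linear in its first argument). -/
def ofVec (f : H) : S.GenVec :=
  ⟨{ toFun := fun φ => inner 𝕜 (φ : H) f
     map_add' := fun φ ψ => inner_add_left _ _ _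
     map_smul' := fun c φ => inner_smul_left _ _ _ },
   0, ‖f‖, fun φ => by
    have h := S.norm_pow_le_testSeminorm (le_refl 0) φ
    calc ‖inner 𝕜 (φ : H) f‖ ≤ ‖(φ : H)‖ * ‖f‖ := norm_inner_le_norm _ _
      _ ≤ S.testSeminorm 0 φ * ‖f‖ := mul_le_mul_of_nonneg_right h (norm_nonneg f)
      _ = _ := mul_comm _ _⟩

/-- The Fourier coefficient `(u, e ζ)` of a generalised vector: `u` evaluated at `e ζ`. For
`u = f ∈ H` this is `⟪e ζ, f⟫`. -/
def coeff (ζ : ι) : S.GenVec →ₗ[𝕜] 𝕜 where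
  toFun u := u.1 (S.eTest ζ)
  map_add' _ _ := rfl
  map_smul' _ _ := rfl

/-- The operator `L` on generalised vectors, by duality: `(L u)(φ) = u (L φ)`. -/
def genOp : S.GenVec →ₗ[𝕜] S.GenVec where
  toFun u := ⟨u.1.comp S.testOp, by
    obtain ⟨k, C, hu⟩ := u.2
    refine ⟨k + 1, |C|, fun φ => (hu (S.testOp φ)).trans ?_⟩
    exact mul_le_mul (le_abs_self C) (S.testSeminorm_testOp_le k φ) (S.testSeminorm_nonneg _ _)
      (abs_nonneg C)⟩
  map_add' _ _ := rfl
  map_smul' _ _ := rfl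

/-- The Fourier coefficients of `(1 + L)^(δ/2) u`. -/
def weightedCoeff (δ : ℝ) (u : S.GenVec) (ζ : ι) : 𝕜 :=
  (((1 + S.γ ζ) ^ (δ / 2) : ℝ) : 𝕜) * S.coeff ζ u

lemma weightedCoeff_add (δ : ℝ) (u v : S.GenVec) :
    S.weightedCoeff δ (u + v) = S.weightedCoeff δ u + S.weightedCoeff δ v := by
  funext ζ
  simp [weightedCoeff, mul_add]

lemma weightedCoeff_smul (δ : ℝ) (c : 𝕜) (u : S.GenVec) :
    S.weightedCoeff δ (c • u) = c • S.weightedCoeff δ u := by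
  funext ζ
  simp only [weightedCoeff, map_smul, smul_eq_mul, Pi.smul_apply]
  ring

/-- The Sobolev space `H^δ`: the generalised vectors `u` with `(1 + L)^(δ/2) u ∈ H`, i.e. with
square summable family `(1 + γ ζ)^(δ/2) (u, e ζ)`. -/
def sobolev (δ : ℝ) : Submodule 𝕜 S.GenVec where
  carrier := {u | Memℓp (S.weightedCoeff δ u) 2}
  zero_mem' := by
    have h : S.weightedCoeff δ 0 = 0 := by
      funext ζ
      simp [weightedCoeff]
    change Memℓp (S.weightedCoeff δ 0) 2
    rw [h]
    exact zero_memℓp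
  add_mem' := by
    intro u v hu hv
    change Memℓp (S.weightedCoeff δ (u + v)) 2
    rw [weightedCoeff_add]
    exact Memℓp.add hu hv
  smul_mem' := by
    intro c u hu
    change Memℓp (S.weightedCoeff δ (c • u)) 2
    rw [weightedCoeff_smul]
    exact Memℓp.const_smul hu c

/-- The map `u ↦ (1 + L)^(δ/2) u` from `H^δ` to `ℓ²`, on the side of Fourier coefficients. -/
def sobolevToL2 (δ : ℝ) : S.sobolev δ →ₗ[𝕜] lp (fun _ : ι => 𝕜) 2 where
  toFun u := ⟨S.weightedCoeff δ u, u.2⟩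
  map_add' u v := Subtype.ext (S.weightedCoeff_add δ u v)
  map_smul' c u := Subtype.ext (S.weightedCoeff_smul δ c u)

/-! A generalised vector is determined by its Fourier coefficients, so that the Sobolev norms are
norms. -/

lemma inner_e_apply (g : S.L.domain) (ζ : ι) :
    inner 𝕜 (S.e ζ) (S.L g) = (S.γ ζ : 𝕜) * inner 𝕜 (S.e ζ) (g : H) := by
  have hres : (-1 : 𝕜) ∉ unboundedSpectrum S.L := by
    rw [S.spectrum_eq]
    rintro ⟨η, hη⟩
    have h1 : ((S.γ η : ℝ) : 𝕜) = ((-1 : ℝ) : 𝕜) := by simpa using hη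
    have h2 : S.γ η = -1 := by exact_mod_cast h1
    have := S.gamma_nonneg η
    linarith
  obtain ⟨R, -, hR⟩ := not_not.1 hres
  have hne : ∀ η, (1 + (S.γ η : 𝕜)) ≠ 0 := fun η => by
    have h := (S.one_add_gamma_pos η).ne'
    have h' : ((1 + S.γ η : ℝ) : 𝕜) ≠ 0 := by exact_mod_cast h
    simpa using h'
  have hRe : ∀ η, R (S.e η) = (1 + (S.γ η : 𝕜))⁻¹ • S.e η := fun η => by
    have h := hR ⟨S.e η, S.e_mem η⟩
    rw [S.eigen] at h
    have h' : R ((1 + (S.γ η : 𝕜)) • S.e η) = S.e η := by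
      rw [add_smul, one_smul, add_comm]
      simpa using h
    rw [map_smul] at h'
    rw [eq_inv_smul_iff₀ (hne η), h']
  have hAB : (innerSL 𝕜 (S.e ζ)).comp R = (1 + (S.γ ζ : 𝕜))⁻¹ • innerSL 𝕜 (S.e ζ) := by
    refine ContinuousLinearMap.ext_on (s := Set.range S.e) ?_ ?_
    · rw [Submodule.dense_iff_topologicalClosure_eq_top]
      exact S.e.dense_span
    · rintro _ ⟨η, rfl⟩
      simp only [ContinuousLinearMap.comp_apply, hRe, map_smul, innerSL_apply_apply,
        _root_.smul_apply, smul_eq_mul]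
      by_cases h : ζ = η
      · rw [h]
      · rw [S.e.orthonormal.2 h]
        simp
  have h := congrArg (fun T : H →L[𝕜] 𝕜 => T (S.L g - (-1 : 𝕜) • (g : H))) hAB
  simp only [ContinuousLinearMap.comp_apply, hR, innerSL_apply_apply,
    _root_.smul_apply, smul_eq_mul, inner_sub_right, inner_smul_right] at h
  rw [eq_inv_mul_iff_mul_eq₀ (hne ζ)] at h
  linear_combination -h

lemma inner_e_testOp_pow (j : ℕ) (φ : S.testSpace) (ζ : ι) :
    inner 𝕜 (S.e ζ) (((S.testOp ^ j) φ : S.testSpace) : H)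
      = (S.γ ζ : 𝕜) ^ j * inner 𝕜 (S.e ζ) (φ : H) := by
  induction j with
  | zero => simp
  | succ j ih =>
    rw [pow_succ', Module.End.mul_apply, coe_testOp, inner_e_apply, ih, pow_succ']
    ring

lemma hasSum_testOp_pow (j : ℕ) (φ : S.testSpace) :
    Tendsto (fun F : Finset ι => (((S.testOp ^ j)
      (φ - ∑ ζ ∈ F, inner 𝕜 (S.e ζ) (φ : H) • S.eTest ζ) : S.testSpace) : H)) atTop (𝓝 0) := by
  have h := S.e.hasSum_repr (((S.testOp ^ j) φ : S.testSpace) : H)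
  have h' := (tendsto_const_nhds (x := (((S.testOp ^ j) φ : S.testSpace) : H))).sub h
  rw [sub_self] at h'
  refine h'.congr fun F => ?_
  rw [map_sub, map_sum, Submodule.coe_sub, Submodule.coe_sum]
  congr 1
  refine Finset.sum_congr rfl fun ζ _ => ?_
  have h1 := S.e.repr_apply_apply (((S.testOp ^ j) φ : S.testSpace) : H) ζ
  rw [inner_e_testOp_pow, mul_comm] at h1
  rw [map_smul, testOp_pow_eTest, smul_smul]
  exact congrArg (fun c : 𝕜 => c • S.e ζ) h1

lemma genVec_ext {u : S.GenVec} (h : ∀ ζ, S.coeff ζ u = 0) : u = 0 := by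
  refine Subtype.ext (LinearMap.ext fun φ => ?_)
  change u.1 φ = 0
  obtain ⟨k, C, hu⟩ := u.2
  have hsum : Tendsto (fun F : Finset ι => |C| * ∑ j ∈ Finset.range (k + 1),
      ‖(((S.testOp ^ j) (φ - ∑ ζ ∈ F, inner 𝕜 (S.e ζ) (φ : H) • S.eTest ζ) :
        S.testSpace) : H)‖) atTop (𝓝 0) := by
    have h0 : Tendsto (fun F : Finset ι => ∑ j ∈ Finset.range (k + 1),
        ‖(((S.testOp ^ j) (φ - ∑ ζ ∈ F, inner 𝕜 (S.e ζ) (φ : H) • S.eTest ζ) :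
          S.testSpace) : H)‖) atTop (𝓝 (∑ j ∈ Finset.range (k + 1), (0 : ℝ))) :=
      tendsto_finsetSum _ fun j _ => by simpa using (S.hasSum_testOp_pow j φ).norm
    simpa using h0.const_mul |C|
  have hle : ∀ F : Finset ι, ‖u.1 φ‖ ≤ |C| * ∑ j ∈ Finset.range (k + 1),
      ‖(((S.testOp ^ j) (φ - ∑ ζ ∈ F, inner 𝕜 (S.e ζ) (φ : H) • S.eTest ζ) :
        S.testSpace) : H)‖ := fun F => by
    have h1 : u.1 (φ - ∑ ζ ∈ F, inner 𝕜 (S.e ζ) (φ : H) • S.eTest ζ) = u.1 φ := by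
      rw [map_sub, map_sum, Finset.sum_eq_zero, sub_zero]
      intro ζ _
      rw [map_smulₛₗ]
      have h2 : u.1 (S.eTest ζ) = 0 := h ζ
      rw [h2, smul_zero]
    rw [← h1]
    refine (hu _).trans (mul_le_mul (le_abs_self C) ?_ (S.testSeminorm_nonneg _ _) (abs_nonneg C))
    refine S.testSeminorm_le (Finset.sum_nonneg fun j _ => norm_nonneg _) fun j hj => ?_
    exact Finset.single_le_sum (f := fun j => ‖(((S.testOp ^ j)
      (φ - ∑ ζ ∈ F, inner 𝕜 (S.e ζ) (φ : H) • S.eTest ζ) : S.testSpace) : H)‖)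
      (fun j _ => norm_nonneg _) (Finset.mem_range.2 (Nat.lt_succ_of_le hj))
  exact norm_le_zero_iff.1 (ge_of_tendsto' hsum hle)

lemma sobolevToL2_injective (δ : ℝ) : Function.Injective (S.sobolevToL2 δ) := by
  rw [injective_iff_map_eq_zero]
  intro u hu
  refine Subtype.ext (S.genVec_ext fun ζ => ?_)
  have h : S.weightedCoeff δ u ζ = 0 := congrFun (congrArg Subtype.val hu) ζ
  have hpos : (0 : ℝ) < (1 + S.γ ζ) ^ (δ / 2) := Real.rpow_pos_of_pos (S.one_add_gamma_pos ζ) _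
  exact (mul_eq_zero.1 h).resolve_left (by exact_mod_cast hpos.ne')

/-- The norm of `H^δ`: `‖u‖_δ = ‖(1 + L)^(δ/2) u‖`. -/
instance sobolevNormedAddCommGroup (δ : ℝ) : NormedAddCommGroup (S.sobolev δ) :=
  NormedAddCommGroup.induced _ _ (S.sobolevToL2 δ) (S.sobolevToL2_injective δ)

instance sobolevNormedSpace (δ : ℝ) : NormedSpace 𝕜 (S.sobolev δ) :=
  NormedSpace.induced 𝕜 _ _ (S.sobolevToL2 δ)

/-- The Sobolev norm in terms of Fourier coefficients. -/
lemma sobolev_norm_eq (δ : ℝ) (u : S.sobolev δ) :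
    ‖u‖ = Real.sqrt (∑' ζ, (1 + S.γ ζ) ^ δ * ‖S.coeff ζ (u : S.GenVec)‖ ^ 2) := by
  have h : ‖u‖ = ‖S.sobolevToL2 δ u‖ := rfl
  rw [h, lp.norm_eq_tsum_rpow (by norm_num), Real.sqrt_eq_rpow]
  norm_num
  congr 2
  funext ζ
  have hpos := S.one_add_gamma_pos ζ
  change ‖S.weightedCoeff δ u ζ‖ ^ 2 = _
  rw [weightedCoeff, norm_mul, RCLike.norm_ofReal, mul_pow, sq_abs, ← Real.rpow_natCast,
    ← Real.rpow_mul hpos.le]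
  norm_num

lemma coeff_ofVec_e (ζ η : ι) : S.coeff η (S.ofVec (S.e ζ)) = inner 𝕜 (S.e η) (S.e ζ) := rfl

/-- The eigenvector `e ζ` as an element of `H^δ`. -/
def eSobolev (δ : ℝ) (ζ : ι) : S.sobolev δ :=
  ⟨S.ofVec (S.e ζ), by
    classical
    have h : S.weightedCoeff δ (S.ofVec (S.e ζ))
        = (lp.single (E := fun _ : ι => 𝕜) 2 ζ (((1 + S.γ ζ) ^ (δ / 2) : ℝ) : 𝕜)
            : lp (fun _ : ι => 𝕜) 2) := by
      funext η
      rw [weightedCoeff, coeff_ofVec_e]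
      by_cases hη : η = ζ
      · subst hη
        simp [S.e.orthonormal.1 η]
      · rw [S.e.orthonormal.2 hη, lp.single_apply_ne _ _ _ hη, mul_zero]
    change Memℓp (S.weightedCoeff δ (S.ofVec (S.e ζ))) 2
    rw [h]
    exact lp.memℓp _⟩

/-- The operator `L` in the space `H^δ`, with domain `{u ∈ H^δ : L u ∈ H^δ}`. -/
def sobolevOp (δ : ℝ) : S.sobolev δ →ₗ.[𝕜] S.sobolev δ where
  domain := (S.sobolev δ).comap (S.genOp ∘ₗ (S.sobolev δ).subtype)
  toFun :=
    (S.genOp ∘ₗ (S.sobolev δ).subtype ∘ₗ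
      ((S.sobolev δ).comap (S.genOp ∘ₗ (S.sobolev δ).subtype)).subtype).codRestrict
      (S.sobolev δ) fun u => u.2

/-- `w` is the unique continuous solution in `H^δ` of `∂^β w + L w = 0`, `w(0) = w₀ ∈ H^δ`, and it is
given by `w(t) = ∑ ζ, (w₀, e ζ) E_β(-γ ζ t^β) e ζ` with convergence in `H^δ`. Uniqueness is meant in
the whole Sobolev scale: every continuous solution in any `H^σ` with the same initial value agrees
with `w`. -/
structure IsUniqueSolution (δ β : ℝ) (w₀ : S.sobolev δ) (w : ℝ → S.sobolev δ) : Prop where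
  solution : IsHeatSolution (S.sobolevOp δ) β w₀ w
  series : ∀ t : ℝ, 0 ≤ t → HasSum
    (fun ζ => (S.coeff ζ (w₀ : S.GenVec) * ((mittagLeffler β 1 (-S.γ ζ * t ^ β) : ℝ) : 𝕜)) •
      S.eSobolev δ ζ) (w t)
  unique : ∀ (σ : ℝ) (v₀ : S.sobolev σ) (v : ℝ → S.sobolev σ),
    (v₀ : S.GenVec) = w₀ → IsHeatSolution (S.sobolevOp σ) β v₀ v →
      ∀ t : ℝ, 0 ≤ t → (v t : S.GenVec) = w t

end PositiveDiscreteOperator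

end

noncomputable section

/-! ### The Mittag-Leffler function -/

/-! The whole problem is diagonal. Since `γ ≥ 0`, the point `-1` is outside the spectrum, and the
resolvent there shows that `L` multiplies the coefficients of each vector of its domain by `γ`
(`inner_e_apply`) and that its domain is the largest one possible (`mem_domain_of_repr`). The basis
identifies `H` with `ℓ²`, and `sobolevIso` does the same for `H^δ`, so that in every case the
equation splits into the scalar equations `∂^β z + γ z = 0`, solved by `z(0) E_β(-γ t^β)`.

Uniqueness is a Volterra argument. If `z(0) = 0`, the primitive `Z` of `z` satisfies `Z = λ I^β Z`,
and iteration bounds `Z` by the terms of a convergent Mittag-Leffler series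
(`eq_zero_of_caputo_eq`). Applied to each coefficient, this gives uniqueness at once in the whole
scale, because a generalised vector is determined by its coefficients.

Existence and the estimates need bounds on `u(t) = E_β(-t^β)`, obtained here by real-variable means.
Its derivative is `-t^(β-1) E_{β,β}(-t^β)`, and `E_{β,β}` has no zero on the negative half-line: at
a first zero, the fractional integral of order `1 - β` of the positive kernel would have to be
strictly decreasing and stationary at the same time (`not_hasDerivAt_zero_of_first_zero`). So `u`
decreases from `1`. It is nonnegative because its integrals over `[0, t]` are, and `1 - u = I^β u ≥
u t^β / Γ(β+1)` gives `E_β(-x) (1 + x / Γ(β+1)) ≤ 1`.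

Thus `E_β(-γ t^β)` is a multiplier bounded by `1`, and `γ E_β(-γ t^β)` one bounded by `Γ(β+1)
t^(-β)`, uniformly in `γ`. Dominated convergence in `ℓ²` yields continuity, and an integrated form
of the equation, tested on coordinates, yields the Caputo derivative in norm
(`hasCaputoDerivAt_of_coord`). The three estimates are bounds on these multipliers. -/

lemma Real.rpow_mul_exp_neg_le_Gamma {R y : ℝ} (hR : 0 < R) (hy : 1 ≤ y) :
    R ^ (y - 1) * Real.exp (-R) ≤ Real.Gamma y := by
  have hy0 : 0 < y := by linarith
  rw [Real.Gamma_eq_integral hy0]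
  have hint : IntegrableOn (fun x : ℝ => Real.exp (-x) * x ^ (y - 1)) (Set.Ioi 0) :=
    Real.GammaIntegral_convergent hy0
  -- Only the part of the Gamma integral over `(R, ∞)` is kept; there `x ^ (y - 1) ≥ R ^ (y - 1)`
  -- because `y ≥ 1`.
  have h1 : ∫ x in Set.Ioi R, Real.exp (-x) * x ^ (y - 1)
      ≤ ∫ x in Set.Ioi (0 : ℝ), Real.exp (-x) * x ^ (y - 1) := by
    refine setIntegral_mono_set hint ?_ (Set.Ioi_subset_Ioi hR.le).eventuallyLE
    filter_upwards [ae_restrict_mem measurableSet_Ioi] with x hx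
    have : (0 : ℝ) < x := hx
    positivity
  have h2 : ∫ x in Set.Ioi R, Real.exp (-x) * R ^ (y - 1)
      ≤ ∫ x in Set.Ioi R, Real.exp (-x) * x ^ (y - 1) := by
    refine setIntegral_mono_on ((integrableOn_exp_neg_Ioi R).mul_const _)
      (hint.mono_set (Set.Ioi_subset_Ioi hR.le)) measurableSet_Ioi fun x hx => ?_
    have hx' : R ≤ x := le_of_lt hx
    gcongr
  rw [integral_mul_const, integral_exp_neg_Ioi] at h2
  linarith

lemma summable_mittagLeffler {ν ρ : ℝ} (hν : 0 < ν) (hρ : 0 < ρ) (x : ℝ) :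
    Summable fun k : ℕ => x ^ k / Real.Gamma (ν * k + ρ) := by
  -- With `R ^ ν = 2(|x| + 1)` the lower bound for `Γ` grows like `(2(|x| + 1))^k`, which leaves a
  -- geometric series of ratio `1/2`. The bound needs `ν k + ρ ≥ 1`, hence holds only for large `k`.
  set R : ℝ := (2 * (|x| + 1)) ^ (1 / ν) with hR
  have hx1 : (0 : ℝ) < 2 * (|x| + 1) := by positivity
  have hR0 : 0 < R := Real.rpow_pos_of_pos hx1 _
  have hRν : R ^ ν = 2 * (|x| + 1) := by
    rw [hR, ← Real.rpow_mul hx1.le, one_div_mul_cancel hν.ne', Real.rpow_one]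
  have hgeom : Summable fun k : ℕ => Real.exp R * R ^ (1 - ρ) * (1 / 2 : ℝ) ^ k :=
    (summable_geometric_of_lt_one (by norm_num) (by norm_num)).mul_left _
  refine Summable.of_norm_bounded_eventually_nat hgeom ?_
  obtain ⟨N, hN⟩ := exists_nat_ge (1 / ν)
  filter_upwards [eventually_ge_atTop N] with k hk
  have hk1 : 1 ≤ ν * k + ρ := by
    have : 1 / ν ≤ k := hN.trans (by exact_mod_cast hk)
    rw [div_le_iff₀ hν] at this
    linarith
  have hG := Real.rpow_mul_exp_neg_le_Gamma hR0 hk1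
  have hG0 : 0 < Real.Gamma (ν * k + ρ) := Real.Gamma_pos_of_pos (by positivity)
  rw [norm_div, norm_pow, Real.norm_eq_abs, Real.norm_eq_abs, abs_of_pos hG0, div_le_iff₀ hG0]
  have hpow : R ^ (ν * k + ρ - 1) = (2 * (|x| + 1)) ^ k * R ^ (ρ - 1) := by
    rw [add_sub_assoc, Real.rpow_add hR0, Real.rpow_mul hR0.le, hRν, Real.rpow_natCast]
  calc |x| ^ k ≤ (|x| + 1) ^ k := by gcongr; linarith
    _ = Real.exp R * R ^ (1 - ρ) * (1 / 2 : ℝ) ^ k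
        * (R ^ (ν * k + ρ - 1) * Real.exp (-R)) := by
      have e1 : Real.exp R * Real.exp (-R) = 1 := by rw [← Real.exp_add]; simp
      have e2 : R ^ (1 - ρ) * R ^ (ρ - 1) = 1 := by rw [← Real.rpow_add hR0]; simp
      have e3 : (1 / 2 : ℝ) ^ k * 2 ^ k = 1 := by rw [← mul_pow]; norm_num
      rw [hpow, mul_pow]
      calc (|x| + 1) ^ k = (|x| + 1) ^ k * (Real.exp R * Real.exp (-R))
            * (R ^ (1 - ρ) * R ^ (ρ - 1)) * ((1 / 2 : ℝ) ^ k * 2 ^ k) := by rw [e1, e2, e3]; ring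
        _ = _ := by ring
    _ ≤ _ := by gcongr

lemma mittagLeffler_zero (ν ρ : ℝ) : mittagLeffler ν ρ 0 = (Real.Gamma ρ)⁻¹ := by
  rw [mittagLeffler, tsum_eq_single 0 fun k hk => by simp [hk]]
  simp

lemma mittagLeffler_eq_add {ν ρ : ℝ} (hν : 0 < ν) (hρ : 0 < ρ) (x : ℝ) :
    mittagLeffler ν ρ x = (Real.Gamma ρ)⁻¹ + x * mittagLeffler ν (ρ + ν) x := by
  rw [mittagLeffler, (summable_mittagLeffler hν hρ x).tsum_eq_zero_add, mittagLeffler,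
    ← tsum_mul_left]
  congr 1
  · simp
  · refine tsum_congr fun k => ?_
    rw [pow_succ, show ν * ((k + 1 : ℕ) : ℝ) + ρ = ν * k + (ρ + ν) by push_cast; ring]
    ring

lemma analyticAt_mittagLeffler {ν ρ : ℝ} (hν : 0 < ν) (hρ : 0 < ρ) (x : ℝ) :
    AnalyticAt ℝ (mittagLeffler ν ρ) x := by
  set c : ℕ → ℝ := fun k => (Real.Gamma (ν * k + ρ))⁻¹ with hc
  have hsum : (FormalMultilinearSeries.ofScalars ℝ c).sum = mittagLeffler ν ρ := by
    funext y
    have := congrFun (FormalMultilinearSeries.ofScalarsSum_eq_tsum (E := ℝ) c) y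
    refine this.trans (tsum_congr fun k => ?_)
    simp only [hc, smul_eq_mul]
    rw [mul_comm, div_eq_mul_inv]
  have hrad : (FormalMultilinearSeries.ofScalars ℝ c).radius = ⊤ := by
    refine FormalMultilinearSeries.radius_eq_top_of_summable_norm _ fun r => ?_
    refine (summable_mittagLeffler hν hρ r).congr fun k => ?_
    have hG0 : 0 < Real.Gamma (ν * k + ρ) := Real.Gamma_pos_of_pos (by positivity)
    rw [FormalMultilinearSeries.ofScalars_norm, hc, norm_inv, Real.norm_eq_abs, abs_of_pos hG0,
      div_eq_inv_mul]
  have h := (FormalMultilinearSeries.ofScalars ℝ c).hasFPowerSeriesOnBall (by simp [hrad])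
  rw [hsum, hrad] at h
  exact h.analyticAt_of_mem (by simp)

lemma continuous_mittagLeffler {ν ρ : ℝ} (hν : 0 < ν) (hρ : 0 < ρ) :
    Continuous (mittagLeffler ν ρ) :=
  continuous_iff_continuousAt.2 fun x => (analyticAt_mittagLeffler hν hρ x).continuousAt

lemma mittagLeffler_one_one (x : ℝ) : mittagLeffler 1 1 x = Real.exp x := by
  rw [mittagLeffler, Real.exp_eq_exp_ℝ, NormedSpace.exp_eq_tsum_div]
  refine tsum_congr fun k => ?_
  rw [one_mul, Real.Gamma_nat_eq_factorial]

/-! ### Riemann-Liouville integrals of powers -/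

lemma integral_sub_rpow_mul_rpow {a b t : ℝ} (ha : 0 < a) (hb : 0 < b) (ht : 0 < t) :
    ∫ s in (0 : ℝ)..t, (t - s) ^ (a - 1) * s ^ (b - 1)
      = t ^ (a + b - 1) * (Real.Gamma a * Real.Gamma b / Real.Gamma (a + b)) := by
  have h := Complex.betaIntegral_scaled (b : ℂ) (a : ℂ) ht
  rw [Complex.betaIntegral_eq_Gamma_mul_div _ _ (by simpa using hb) (by simpa using ha)] at h
  have h1 : ∫ s in (0 : ℝ)..t, (s : ℂ) ^ ((b : ℂ) - 1) * ((t : ℂ) - s) ^ ((a : ℂ) - 1)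
      = ∫ s in (0 : ℝ)..t, (((t - s) ^ (a - 1) * s ^ (b - 1) : ℝ) : ℂ) := by
    refine intervalIntegral.integral_congr fun s hs => ?_
    rw [Set.uIcc_of_le ht.le] at hs
    rw [Complex.ofReal_mul, Complex.ofReal_cpow (by linarith [hs.2]), Complex.ofReal_cpow hs.1]
    push_cast
    ring
  rw [h1, intervalIntegral.integral_ofReal, ← Complex.ofReal_add, Complex.Gamma_ofReal,
    Complex.Gamma_ofReal, Complex.Gamma_ofReal,
    show ((b + a : ℝ) : ℂ) - 1 = ((b + a - 1 : ℝ) : ℂ) by push_cast; ring,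
    ← Complex.ofReal_cpow ht.le] at h
  have h2 : ∫ s in (0 : ℝ)..t, (t - s) ^ (a - 1) * s ^ (b - 1)
      = t ^ (b + a - 1) * (Real.Gamma b * Real.Gamma a / Real.Gamma (b + a)) := by
    exact_mod_cast h
  rw [h2, add_comm b a, mul_comm (Real.Gamma b)]

/-- A non-integrable function has integral `0` by convention, whereas the beta integral is positive.
-/
lemma intervalIntegrable_sub_rpow_mul_rpow {a b t : ℝ} (ha : 0 < a) (hb : 0 < b) (ht : 0 < t) :
    IntervalIntegrable (fun s => (t - s) ^ (a - 1) * s ^ (b - 1)) volume 0 t := by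
  by_contra h
  have h1 := integral_sub_rpow_mul_rpow ha hb ht
  rw [intervalIntegral.integral_undef h] at h1
  have := Real.Gamma_pos_of_pos ha
  have := Real.Gamma_pos_of_pos hb
  have := Real.Gamma_pos_of_pos (add_pos ha hb)
  have : 0 < t ^ (a + b - 1) * (Real.Gamma a * Real.Gamma b / Real.Gamma (a + b)) := by positivity
  linarith

lemma rlIntegral_of_pos {X : Type*} [NormedAddCommGroup X] [NormedSpace ℝ X] {α : ℝ} (hα : 0 < α)
    (f : ℝ → X) (t : ℝ) :
    rlIntegral α f t = (Real.Gamma α)⁻¹ • ∫ s in (0 : ℝ)..t, (t - s) ^ (α - 1) • f s := by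
  rw [rlIntegral, if_neg hα.ne']

lemma rlIntegral_one {X : Type*} [NormedAddCommGroup X] [NormedSpace ℝ X]
    (f : ℝ → X) (t : ℝ) : rlIntegral 1 f t = ∫ s in (0 : ℝ)..t, f s := by
  rw [rlIntegral_of_pos one_pos]
  simp

lemma rlIntegral_congr {X : Type*} [NormedAddCommGroup X] [NormedSpace ℝ X] {α t : ℝ}
    {f g : ℝ → X} (ht : 0 ≤ t) (h : ∀ s, 0 ≤ s → s ≤ t → f s = g s) :
    rlIntegral α f t = rlIntegral α g t := by
  rw [rlIntegral, rlIntegral]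
  split_ifs
  · exact h t ht le_rfl
  · congr 1
    refine intervalIntegral.integral_congr fun s hs => ?_
    rw [Set.uIcc_of_le ht] at hs
    simp only [h s hs.1 hs.2]

lemma rlIntegral_const_mul (α c : ℝ) (f : ℝ → ℝ) (t : ℝ) :
    rlIntegral α (fun s => c * f s) t = c * rlIntegral α f t := by
  rw [rlIntegral, rlIntegral]
  split_ifs
  · rfl
  · simp only [smul_eq_mul]
    simp only [mul_left_comm _ c]
    rw [intervalIntegral.integral_const_mul, mul_left_comm]

/-- The beta integral in its fractional form. Order `a = 0` is allowed since `I^(1-β)` is the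
identity for `β = 1`. -/
lemma rlIntegral_rpow {a b t : ℝ} (ha : 0 ≤ a) (hb : 0 < b) (ht : 0 < t) :
    rlIntegral a (fun s => s ^ (b - 1) / Real.Gamma b) t
      = t ^ (a + b - 1) / Real.Gamma (a + b) := by
  rcases ha.eq_or_lt with rfl | ha
  · simp [rlIntegral]
  have := Real.Gamma_pos_of_pos ha
  have := Real.Gamma_pos_of_pos hb
  rw [rlIntegral_of_pos ha]
  simp only [smul_eq_mul, ← mul_div_assoc]
  rw [intervalIntegral.integral_div, integral_sub_rpow_mul_rpow ha hb ht]
  field_simp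

/-- The function `s^(b-1) E_{β,b}(-lam s^β)`, whose Laplace transform is
`z^(β-b) / (z^β + lam)`. -/
def mlKernel (β b lam s : ℝ) : ℝ := s ^ (b - 1) * mittagLeffler β b (-lam * s ^ β)

lemma hasSum_mlKernel {β b : ℝ} (hβ : 0 < β) (hb : 0 < b) (lam : ℝ) {s : ℝ} (hs : 0 < s) :
    HasSum (fun k : ℕ => (-lam) ^ k * (s ^ (β * k + b - 1) / Real.Gamma (β * k + b)))
      (mlKernel β b lam s) := by
  refine ((summable_mittagLeffler hβ hb (-lam * s ^ β)).hasSum.mul_left (s ^ (b - 1))).congr_fun ?_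
  intro k
  rw [add_sub_assoc, Real.rpow_add hs, Real.rpow_mul hs.le, Real.rpow_natCast, mul_pow]
  ring

/-- Termwise, this is the power rule. The interchange is licensed because the integrals of the
absolute values add up to the same series with `|lam|` in place of `-lam`. All fractional calculus
of the scalar solution reduces to this shift of the second index. -/
lemma rlIntegral_mlKernel {β a b : ℝ} (hβ : 0 < β) (ha : 0 ≤ a) (hb : 0 < b) (lam : ℝ) {t : ℝ}
    (ht : 0 < t) : rlIntegral a (mlKernel β b lam) t = mlKernel β (a + b) lam t := by
  rcases ha.eq_or_lt with rfl | ha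
  · simp [rlIntegral]
  have hbk : ∀ k : ℕ, 0 < β * k + b := fun k => by positivity
  have hG := Real.Gamma_pos_of_pos ha
  set F : ℕ → ℝ → ℝ := fun k s =>
    (t - s) ^ (a - 1) * ((-lam) ^ k * (s ^ (β * k + b - 1) / Real.Gamma (β * k + b))) with hF
  have hFeq : ∀ k, F k = fun s => ((-lam) ^ k / Real.Gamma (β * k + b)) *
      ((t - s) ^ (a - 1) * s ^ (β * k + b - 1)) := fun k => by
    funext s
    simp only [hF]
    ring
  have hFint : ∀ k, IntervalIntegrable (F k) volume 0 t := fun k => by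
    rw [hFeq]
    exact (intervalIntegrable_sub_rpow_mul_rpow ha (hbk k) ht).const_mul _
  have hval : ∀ (k : ℕ), (Real.Gamma a)⁻¹ *
      ∫ s in (0 : ℝ)..t, (t - s) ^ (a - 1) * (s ^ (β * k + b - 1) / Real.Gamma (β * k + b))
      = t ^ (β * k + (a + b) - 1) / Real.Gamma (β * k + (a + b)) := fun k => by
    have h := rlIntegral_rpow ha.le (hbk k) ht
    rw [rlIntegral_of_pos ha] at h
    simp only [smul_eq_mul] at h
    rw [h, show a + (β * k + b) = β * k + (a + b) by ring]
  have hFval : ∀ k : ℕ, ∫ s in (0 : ℝ)..t, F k s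
      = Real.Gamma a * ((-lam) ^ k * (t ^ (β * k + (a + b) - 1) / Real.Gamma (β * k + (a + b)))) :=
    fun k => by
      rw [← hval]
      simp only [hF, mul_left_comm _ ((-lam) ^ k)]
      rw [intervalIntegral.integral_const_mul]
      field_simp
  have hnorm : ∀ k : ℕ, ∫ s in Set.Ioc 0 t, ‖F k s‖
      = Real.Gamma a * (|lam| ^ k * (t ^ (β * k + (a + b) - 1) / Real.Gamma (β * k + (a + b)))) :=
    fun k => by
      rw [← hval, ← intervalIntegral.integral_of_le ht.le]
      have : ∀ s ∈ Set.uIcc 0 t, ‖F k s‖ = |lam| ^ k *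
          ((t - s) ^ (a - 1) * (s ^ (β * k + b - 1) / Real.Gamma (β * k + b))) := fun s hs => by
        rw [Set.uIcc_of_le ht.le] at hs
        have h1 : 0 ≤ (t - s) ^ (a - 1) := Real.rpow_nonneg (by linarith [hs.2]) _
        have h2 : 0 ≤ s ^ (β * k + b - 1) / Real.Gamma (β * k + b) :=
          div_nonneg (Real.rpow_nonneg hs.1 _) (Real.Gamma_pos_of_pos (hbk k)).le
        simp only [hF, norm_mul, norm_pow, Real.norm_eq_abs, abs_neg, abs_of_nonneg h1,
          abs_of_nonneg h2]
        ring
      rw [intervalIntegral.integral_congr this, intervalIntegral.integral_const_mul]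
      field_simp
  have hab : 0 < a + b := add_pos ha hb
  have hsumm : Summable fun k : ℕ => ∫ s in Set.Ioc 0 t, ‖F k s‖ := by
    simp only [hnorm]
    have := (hasSum_mlKernel hβ hab (-|lam|) ht).summable.mul_left (Real.Gamma a)
    simpa using this
  have h := MeasureTheory.hasSum_integral_of_summable_integral_norm
    (fun k => (intervalIntegrable_iff_integrableOn_Ioc_of_le ht.le).1 (hFint k)) hsumm
  have hsum : ∫ s in Set.Ioc 0 t, ∑' k, F k s
      = ∫ s in (0 : ℝ)..t, (t - s) ^ (a - 1) • mlKernel β b lam s := by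
    rw [intervalIntegral.integral_of_le ht.le]
    refine setIntegral_congr_fun measurableSet_Ioc fun s hs => ?_
    exact ((hasSum_mlKernel hβ hb lam hs.1).mul_left _).tsum_eq
  rw [hsum] at h
  rw [rlIntegral_of_pos ha, smul_eq_mul, inv_mul_eq_iff_eq_mul₀ hG.ne']
  refine h.unique ?_
  simp only [← intervalIntegral.integral_of_le ht.le, hFval]
  exact (hasSum_mlKernel hβ hab lam ht).mul_left _

lemma mlKernel_one (β lam s : ℝ) : mlKernel β 1 lam s = mittagLeffler β 1 (-lam * s ^ β) := by
  simp [mlKernel]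

/-- The Volterra form `u - 1 = -lam I^β u` of the scalar equation, once the kernel of index `β + 1`
is read as `I^β` of the kernel of index `1`. -/
lemma mittagLeffler_sub_one {β : ℝ} (hβ : 0 < β) (lam s : ℝ) :
    mittagLeffler β 1 (-lam * s ^ β) - 1 = -lam * mlKernel β (β + 1) lam s := by
  rw [mittagLeffler_eq_add hβ one_pos, mlKernel, add_sub_cancel_right, add_comm 1 β]
  simp
  ring

/-! ### Positivity and decay of the Mittag-Leffler function on the negative half-line -/

lemma continuous_mittagLeffler_neg_mul_rpow {β b : ℝ} (hβ : 0 < β) (hb : 0 < b) (lam : ℝ) :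
    Continuous fun s : ℝ => mittagLeffler β b (-lam * s ^ β) :=
  (continuous_mittagLeffler hβ hb).comp
    (continuous_const.mul (Real.continuous_rpow_const hβ.le))

lemma continuousAt_mlKernel {β b : ℝ} (hβ : 0 < β) (hb : 0 < b) (lam : ℝ) {s : ℝ} (hs : 0 < s) :
    ContinuousAt (mlKernel β b lam) s :=
  (Real.continuousAt_rpow_const _ _ (Or.inl hs.ne')).mul
    (continuous_mittagLeffler_neg_mul_rpow hβ hb lam).continuousAt

lemma intervalIntegrable_sub_rpow_mul_mlKernel {β a b : ℝ} (hβ : 0 < β) (ha : 0 < a) (hb : 0 < b)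
    (lam : ℝ) {t : ℝ} (ht : 0 < t) :
    IntervalIntegrable (fun s => (t - s) ^ (a - 1) * mlKernel β b lam s) volume 0 t := by
  simp only [mlKernel, ← mul_assoc]
  exact (intervalIntegrable_sub_rpow_mul_rpow ha hb ht).mul_continuousOn
    (continuous_mittagLeffler_neg_mul_rpow hβ hb lam).continuousOn

lemma intervalIntegrable_mlKernel {β b : ℝ} (hβ : 0 < β) (hb : 0 < b)
    (lam : ℝ) {t : ℝ} (ht : 0 < t) : IntervalIntegrable (mlKernel β b lam) volume 0 t := by
  simpa using intervalIntegrable_sub_rpow_mul_mlKernel hβ one_pos hb lam ht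

lemma integral_mlKernel {β b : ℝ} (hβ : 0 < β) (hb : 0 < b) (lam : ℝ) {t : ℝ} (ht : 0 < t) :
    ∫ s in (0 : ℝ)..t, mlKernel β b lam s = mlKernel β (1 + b) lam t := by
  rw [← rlIntegral_one, rlIntegral_mlKernel hβ zero_le_one hb lam ht]

lemma hasDerivAt_mlKernel_one_add {β b : ℝ} (hβ : 0 < β) (hb : 0 < b) (lam : ℝ) {t : ℝ}
    (ht : 0 < t) : HasDerivAt (mlKernel β (1 + b) lam) (mlKernel β b lam t) t := by
  have hcont : ∀ s ∈ Set.Ioi (0 : ℝ), ContinuousAt (mlKernel β b lam) s := fun s hs =>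
    continuousAt_mlKernel hβ hb lam hs
  have h := intervalIntegral.integral_hasDerivAt_right (intervalIntegrable_mlKernel hβ hb lam ht)
    (ContinuousAt.stronglyMeasurableAtFilter isOpen_Ioi hcont t ht) (hcont t ht)
  refine h.congr_of_eventuallyEq ?_
  filter_upwards [lt_mem_nhds ht] with s hs
  exact (integral_mlKernel hβ hb lam hs).symm

lemma hasDerivAt_mittagLeffler_neg_mul_rpow {β : ℝ} (hβ : 0 < β) (lam : ℝ) {t : ℝ} (ht : 0 < t) :
    HasDerivAt (fun s => mittagLeffler β 1 (-lam * s ^ β)) (-lam * mlKernel β β lam t) t := by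
  have h := ((hasDerivAt_mlKernel_one_add hβ hβ lam ht).const_mul (-lam)).const_add 1
  refine h.congr_of_eventuallyEq ?_
  filter_upwards [lt_mem_nhds ht] with s hs
  have := mittagLeffler_sub_one hβ lam s
  rw [add_comm 1 β]
  linarith

/-- Both sides are multiples of the kernel of index `2`. This is the scalar Caputo equation
integrated once; its sign also yields `∫ u ≥ 0`. -/
lemma rlIntegral_mittagLeffler_sub_one {β : ℝ} (hβ : 0 < β) (hβ1 : β ≤ 1) (lam : ℝ) {t : ℝ}
    (ht : 0 < t) : rlIntegral (1 - β) (fun s => mittagLeffler β 1 (-lam * s ^ β) - 1) t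
      = -lam * ∫ s in (0 : ℝ)..t, mittagLeffler β 1 (-lam * s ^ β) := by
  rw [rlIntegral_congr ht.le (g := fun s => -lam * mlKernel β (β + 1) lam s)
    fun s _ _ => mittagLeffler_sub_one hβ lam s, rlIntegral_const_mul,
    rlIntegral_mlKernel hβ (by linarith) (by linarith) lam ht]
  simp only [← mlKernel_one]
  rw [integral_mlKernel hβ one_pos lam ht]
  congr 2
  ring

/-- Bernoulli's inequality `(1 - r)^β ≤ 1 - β r` with `r = h / y`: moving the endpoint of the
singular kernel back by `h` raises the kernel by at least a fixed multiple of `h`, uniformly for `y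
≤ t`. -/
lemma rpow_neg_add_le {β h y t : ℝ} (hβ : 0 < β) (hβ1 : β ≤ 1) (hh : 0 < h) (hy : h < y)
    (hyt : y ≤ t) : y ^ (-β) + h * (β * t ^ (-β - 1)) ≤ (y - h) ^ (-β) := by
  have hy0 : 0 < y := hh.trans hy
  have hyh : 0 < y - h := sub_pos.2 hy
  set r := h / y with hr
  have hr0 : 0 < r := div_pos hh hy0
  have hr1 : r < 1 := (div_lt_one hy0).2 hy
  have h1 : (1 + -r) ^ β ≤ 1 + β * -r := rpow_one_add_le_one_add_mul_self (by linarith) hβ.le hβ1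
  have hp : 0 < (1 + -r) ^ β := Real.rpow_pos_of_pos (by linarith) _
  have h2 : 1 + β * r ≤ (1 + -r) ^ (-β) := by
    rw [Real.rpow_neg (by linarith), ← one_div, le_div_iff₀ hp]
    have : 0 < 1 + β * r := by positivity
    nlinarith [mul_pos hβ hr0]
  have h3 : y - h = y * (1 + -r) := by rw [hr]; field_simp; ring
  have h4 : t ^ (-β - 1) ≤ y ^ (-β - 1) :=
    Real.rpow_le_rpow_of_nonpos hy0 hyt (by linarith)
  have h5 : y ^ (-β - 1) = y ^ (-β) / y := by rw [Real.rpow_sub_one hy0.ne']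
  rw [h3, Real.mul_rpow hy0.le (by linarith)]
  calc y ^ (-β) + h * (β * t ^ (-β - 1)) ≤ y ^ (-β) + h * (β * y ^ (-β - 1)) := by gcongr
    _ = y ^ (-β) * (1 + β * r) := by rw [h5, hr]; ring
    _ ≤ _ := by gcongr

/-- A positive function cannot have a first zero at a time where the derivative of its
Riemann-Liouville integral of order `1 - β` vanishes. -/
lemma not_hasDerivAt_zero_of_first_zero {β t₀ : ℝ} (hβ : 0 < β) (hβ1 : β < 1) (ht₀ : 0 < t₀)
    {v : ℝ → ℝ} (hint : ∀ t, 0 < t → IntervalIntegrable v volume 0 t)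
    (hint' : ∀ t, 0 < t → IntervalIntegrable (fun s => (t - s) ^ (-β) * v s) volume 0 t)
    (hpos : ∀ s, 0 < s → s < t₀ → 0 < v s) (h0 : v t₀ = 0) (hd : DifferentiableAt ℝ v t₀) :
    ¬ HasDerivAt (fun t => ∫ s in (0 : ℝ)..t, (t - s) ^ (-β) * v s) 0 t₀ := by
  intro hJ
  set J : ℝ → ℝ := fun t => ∫ s in (0 : ℝ)..t, (t - s) ^ (-β) * v s with hJdef
  set κ := β * t₀ ^ (-β - 1) with hκ
  have hκ0 : 0 < κ := by positivity
  -- Stopping at `t₀ / 2` makes this mass independent of `h < t₀ / 2`.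
  set I := ∫ s in (0 : ℝ)..(t₀ / 2), v s with hI
  have hI0 : 0 < I := intervalIntegral.intervalIntegral_pos_of_pos_on (hint _ (by linarith))
    (fun s hs => hpos s hs.1 (by linarith [hs.2])) (by linarith)
  obtain ⟨M, hM⟩ := hd.hasDerivAt.isBigO_sub.bound
  obtain ⟨ε, hε, hMε⟩ := Metric.eventually_nhds_iff.1 hM
  have hMv : ∀ s, t₀ - ε < s → s ≤ t₀ → v s ≤ |M| * (t₀ - s) := fun s hs hs' => by
    have := hMε (y := s) (by rw [Real.dist_eq, abs_lt]; constructor <;> linarith)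
    rw [h0, sub_zero, Real.norm_eq_abs, Real.norm_eq_abs, abs_sub_comm s,
      abs_of_nonneg (sub_nonneg.2 hs')] at this
    calc v s ≤ |v s| := le_abs_self _
      _ ≤ M * (t₀ - s) := this
      _ ≤ _ := mul_le_mul_of_nonneg_right (le_abs_self M) (sub_nonneg.2 hs')
  -- Passing from `t₀` back to `t₀ - h` gains at least `h κ I` on `(0, t₀ - h)`, by the kernel
  -- inequality. It loses only the part over `(t₀ - h, t₀)`, of size `h · O(h^(1-β))` since `v`
  -- vanishes at least linearly at `t₀`. As `h → 0` the quotient stays above a quantity tending to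
  -- `κ I > 0`, so the derivative cannot be `0`.
  have key : ∀ h, 0 < h → h < ε → h < t₀ / 2 →
      κ * I - |M| * h ^ (1 - β) ≤ h⁻¹ • (J (t₀ - h) - J t₀) := by
    intro h hh hhε hht
    have hth : 0 < t₀ - h := by linarith
    have hi1 : IntervalIntegrable (fun s => (t₀ - s) ^ (-β) * v s) volume 0 (t₀ - h) :=
      (hint' t₀ ht₀).mono_set (by
        rw [Set.uIcc_of_le hth.le, Set.uIcc_of_le ht₀.le]
        exact Set.Icc_subset_Icc_right (by linarith))
    have hi2 : IntervalIntegrable (fun s => (t₀ - s) ^ (-β) * v s) volume (t₀ - h) t₀ :=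
      (hint' t₀ ht₀).mono_set (by
        rw [Set.uIcc_of_le (by linarith), Set.uIcc_of_le ht₀.le]
        exact Set.Icc_subset_Icc_left hth.le)
    have hsplit : J t₀ = (∫ s in (0 : ℝ)..(t₀ - h), (t₀ - s) ^ (-β) * v s)
        + ∫ s in (t₀ - h)..t₀, (t₀ - s) ^ (-β) * v s :=
      (intervalIntegral.integral_add_adjacent_intervals hi1 hi2).symm
    have htail : ∫ s in (t₀ - h)..t₀, (t₀ - s) ^ (-β) * v s ≤ h * (|M| * h ^ (1 - β)) := by
      have : ∫ s in (t₀ - h)..t₀, (t₀ - s) ^ (-β) * v s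
          ≤ ∫ _ in (t₀ - h)..t₀, |M| * h ^ (1 - β) := by
        refine intervalIntegral.integral_mono_on_of_le_Ioo (by linarith) hi2 (by simp)
          fun s hs => ?_
        have hs0 : 0 < t₀ - s := by linarith [hs.2]
        calc (t₀ - s) ^ (-β) * v s ≤ (t₀ - s) ^ (-β) * (|M| * (t₀ - s)) := by
              gcongr
              exact hMv s (by linarith [hs.1]) hs.2.le
          _ = |M| * (t₀ - s) ^ (1 - β) := by
              rw [show 1 - β = -β + 1 by ring, Real.rpow_add_one hs0.ne']
              ring
          _ ≤ _ := by
              gcongr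
              linarith [hs.1]
      rw [intervalIntegral.integral_const] at this
      simpa using this
    have hmain : (∫ s in (0 : ℝ)..(t₀ - h), (t₀ - s) ^ (-β) * v s) + h * κ * I ≤ J (t₀ - h) := by
      have hi3 := hint (t₀ - h) hth
      have hI' : I ≤ ∫ s in (0 : ℝ)..(t₀ - h), v s := by
        refine intervalIntegral.integral_mono_interval le_rfl (by linarith) (by linarith) ?_ hi3
        filter_upwards [ae_restrict_mem measurableSet_Ioc] with s hs
        exact (hpos s hs.1 (by linarith [hs.2])).le
      calc (∫ s in (0 : ℝ)..(t₀ - h), (t₀ - s) ^ (-β) * v s) + h * κ * I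
          ≤ (∫ s in (0 : ℝ)..(t₀ - h), (t₀ - s) ^ (-β) * v s)
            + h * κ * ∫ s in (0 : ℝ)..(t₀ - h), v s := by gcongr
        _ = ∫ s in (0 : ℝ)..(t₀ - h), ((t₀ - s) ^ (-β) * v s + h * κ * v s) := by
          rw [intervalIntegral.integral_add hi1 (hi3.const_mul _),
            intervalIntegral.integral_const_mul]
        _ ≤ J (t₀ - h) := by
          refine intervalIntegral.integral_mono_on_of_le_Ioo hth.le
            (hi1.add (hi3.const_mul _)) (hint' _ hth) fun s hs => ?_
          have h1 := rpow_neg_add_le (y := t₀ - s) (t := t₀) hβ hβ1.le hh (by linarith [hs.2])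
            (by linarith [hs.1])
          rw [show t₀ - s - h = t₀ - h - s by ring] at h1
          rw [← add_mul]
          exact mul_le_mul_of_nonneg_right h1 (hpos s hs.1 (by linarith [hs.2])).le
    rw [smul_eq_mul, ← div_eq_inv_mul, le_div_iff₀ hh, hsplit]
    linarith
  have hslope : Tendsto (fun h => h⁻¹ • (J (t₀ - h) - J t₀)) (𝓝[>] 0) (𝓝 0) := by
    have h1 : HasDerivAt (fun h => J (t₀ - h)) 0 0 := by
      have := HasDerivAt.comp_const_sub (f := J) t₀ 0 (f' := 0) (by simpa using hJ)
      simpa using this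
    simpa using h1.tendsto_slope_zero_right
  have hlim : Tendsto (fun h : ℝ => κ * I - |M| * h ^ (1 - β)) (𝓝[>] 0) (𝓝 (κ * I)) := by
    have h1 : Tendsto (fun h : ℝ => h ^ (1 - β)) (𝓝[>] 0) (𝓝 0) := by
      have := (Real.continuous_rpow_const (q := 1 - β) (by linarith)).tendsto 0
      rw [Real.zero_rpow (by linarith)] at this
      exact this.mono_left nhdsWithin_le_nhds
    simpa using tendsto_const_nhds.sub (h1.const_mul |M|)
  have hle : κ * I ≤ 0 := by
    refine le_of_tendsto_of_tendsto hlim hslope ?_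
    have hmin : 0 < min ε (t₀ / 2) := lt_min hε (by linarith)
    filter_upwards [Ioo_mem_nhdsGT hmin] with h hh
    exact key h hh.1 (hh.2.trans_le (min_le_left _ _)) (hh.2.trans_le (min_le_right _ _))
  linarith [mul_pos hκ0 hI0]

lemma differentiableAt_mlKernel {β b : ℝ} (hβ : 0 < β) (hb : 0 < b) (lam : ℝ) {t : ℝ}
    (ht : 0 < t) : DifferentiableAt ℝ (mlKernel β b lam) t := by
  have h1 : DifferentiableAt ℝ (fun s : ℝ => -lam * s ^ β) t :=
    (Real.differentiableAt_rpow_const_of_ne β ht.ne').const_mul _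
  exact (Real.differentiableAt_rpow_const_of_ne _ ht.ne').mul
    ((analyticAt_mittagLeffler hβ hb _).differentiableAt.comp t h1)

/-- At a least zero `x₀ = t₀^β`, the kernel `v(s) = s^(β-1) E_{β,β}(-s^β)` would have its first zero
at `t₀`. But `I^(1-β) v = E_β(-t^β)` has derivative `-v`, which then vanishes at `t₀`: this is the
excluded situation. -/
lemma mittagLeffler_self_neg_pos {β : ℝ} (hβ : 0 < β) (hβ1 : β < 1) {x : ℝ} (hx : 0 ≤ x) :
    0 < mittagLeffler β β (-x) := by
  by_contra! hneg
  have hF : Continuous fun y => mittagLeffler β β (-y) :=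
    (continuous_mittagLeffler hβ hβ).comp continuous_neg
  set Z : Set ℝ := {y | 0 ≤ y ∧ mittagLeffler β β (-y) ≤ 0} with hZ
  have hZc : IsClosed Z := isClosed_Ici.inter (isClosed_Iic.preimage hF)
  have hZb : BddBelow Z := ⟨0, fun y hy => hy.1⟩
  have hmem : sInf Z ∈ Z := hZc.csInf_mem ⟨x, hx, hneg⟩ hZb
  set x₀ := sInf Z with hx₀
  have hlt : ∀ y, 0 ≤ y → y < x₀ → 0 < mittagLeffler β β (-y) := fun y hy hyx => by
    by_contra! h
    exact absurd (csInf_le hZb ⟨hy, h⟩) (not_le.2 hyx)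
  have hx₀pos : 0 < x₀ := by
    refine hmem.1.lt_of_ne fun h => ?_
    have h2 := hmem.2
    rw [← h, neg_zero, mittagLeffler_zero] at h2
    have := Real.Gamma_pos_of_pos hβ
    have : 0 < (Real.Gamma β)⁻¹ := by positivity
    linarith
  have hzero : mittagLeffler β β (-x₀) = 0 := by
    refine le_antisymm hmem.2 ?_
    refine ge_of_tendsto ((hF.tendsto x₀).mono_left nhdsWithin_le_nhds : Tendsto _ (𝓝[<] x₀) _) ?_
    filter_upwards [Ioo_mem_nhdsLT hx₀pos] with y hy
    exact (hlt y hy.1.le hy.2).le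
  set t₀ := x₀ ^ (1 / β) with ht₀
  have ht₀pos : 0 < t₀ := Real.rpow_pos_of_pos hx₀pos _
  have ht₀β : t₀ ^ β = x₀ := by
    rw [ht₀, ← Real.rpow_mul hx₀pos.le, one_div_mul_cancel hβ.ne', Real.rpow_one]
  have hv0 : mlKernel β β 1 t₀ = 0 := by
    rw [mlKernel, ht₀β, neg_one_mul, hzero, mul_zero]
  have e : 1 - β - 1 = -β := by ring
  refine not_hasDerivAt_zero_of_first_zero hβ hβ1 ht₀pos (v := mlKernel β β 1)
    (fun t ht => intervalIntegrable_mlKernel hβ hβ 1 ht) (fun t ht => ?_) (fun s hs hst => ?_) hv0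
    (differentiableAt_mlKernel hβ hβ 1 ht₀pos) ?_
  · rw [← e]
    exact intervalIntegrable_sub_rpow_mul_mlKernel hβ (by linarith) hβ 1 ht
  · rw [mlKernel, neg_one_mul]
    refine mul_pos (Real.rpow_pos_of_pos hs _) (hlt _ (Real.rpow_nonneg hs.le _) ?_)
    rw [← ht₀β]
    exact Real.rpow_lt_rpow hs.le hst hβ
  · have h := (hasDerivAt_mittagLeffler_neg_mul_rpow hβ 1 ht₀pos).const_mul (Real.Gamma (1 - β))
    rw [hv0, mul_zero, mul_zero] at h
    refine h.congr_of_eventuallyEq ?_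
    filter_upwards [lt_mem_nhds ht₀pos] with t ht
    have h1 := rlIntegral_mlKernel hβ (a := 1 - β) (by linarith) hβ 1 ht
    have hG := Real.Gamma_pos_of_pos (s := 1 - β) (by linarith)
    rw [rlIntegral_of_pos (by linarith), e, sub_add_cancel, mlKernel_one, smul_eq_mul,
      inv_mul_eq_iff_eq_mul₀ hG.ne'] at h1
    exact h1

lemma mlKernel_self_nonneg {β : ℝ} (hβ : 0 < β) (hβ1 : β ≤ 1) {s : ℝ} (hs : 0 ≤ s) :
    0 ≤ mlKernel β β 1 s := by
  refine mul_nonneg (Real.rpow_nonneg hs _) ?_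
  rw [neg_one_mul]
  rcases hβ1.eq_or_lt with rfl | h
  · rw [mittagLeffler_one_one]
    positivity
  · exact (mittagLeffler_self_neg_pos hβ h (Real.rpow_nonneg hs _)).le

lemma antitoneOn_mittagLeffler_neg_rpow {β : ℝ} (hβ : 0 < β) (hβ1 : β ≤ 1) :
    AntitoneOn (fun s : ℝ => mittagLeffler β 1 (-1 * s ^ β)) (Set.Ici 0) := by
  refine antitoneOn_of_deriv_nonpos (convex_Ici 0)
    (continuous_mittagLeffler_neg_mul_rpow hβ one_pos 1).continuousOn ?_ ?_
  · intro s hs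
    rw [interior_Ici] at hs
    exact (hasDerivAt_mittagLeffler_neg_mul_rpow hβ 1 hs).differentiableAt.differentiableWithinAt
  · intro s hs
    rw [interior_Ici] at hs
    rw [(hasDerivAt_mittagLeffler_neg_mul_rpow hβ 1 hs).deriv]
    have := mlKernel_self_nonneg hβ hβ1 (le_of_lt hs)
    linarith

lemma mittagLeffler_neg_rpow_le_one {β : ℝ} (hβ : 0 < β) (hβ1 : β ≤ 1) {s : ℝ} (hs : 0 ≤ s) :
    mittagLeffler β 1 (-1 * s ^ β) ≤ 1 := by
  have h := antitoneOn_mittagLeffler_neg_rpow hβ hβ1 (Set.mem_Ici.2 le_rfl) (Set.mem_Ici.2 hs) hs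
  simpa [Real.zero_rpow hβ.ne', mittagLeffler_zero] using h

lemma exists_rpow_eq {β x : ℝ} (hβ : 0 < β) (hx : 0 ≤ x) : ∃ t : ℝ, 0 ≤ t ∧ t ^ β = x :=
  ⟨x ^ β⁻¹, Real.rpow_nonneg hx _, Real.rpow_inv_rpow hx hβ.ne'⟩

lemma mittagLeffler_neg_le_one {β x : ℝ} (hβ : 0 < β) (hβ1 : β ≤ 1) (hx : 0 ≤ x) :
    mittagLeffler β 1 (-x) ≤ 1 := by
  obtain ⟨t, ht, rfl⟩ := exists_rpow_eq hβ hx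
  simpa using mittagLeffler_neg_rpow_le_one hβ hβ1 ht

/-- From `u ≤ 1` and `I^(1-β)(u - 1) = -∫ u`, every integral of `u` over `[0, t]` is nonnegative. A
decreasing `u` that once became negative would stay below a negative constant and violate this. -/
lemma mittagLeffler_neg_nonneg {β x : ℝ} (hβ : 0 < β) (hβ1 : β ≤ 1) (hx : 0 ≤ x) :
    0 ≤ mittagLeffler β 1 (-x) := by
  obtain ⟨t₁, ht₁, rfl⟩ := exists_rpow_eq hβ hx
  rw [← neg_one_mul]
  by_contra! hneg
  set u : ℝ → ℝ := fun s => mittagLeffler β 1 (-1 * s ^ β) with hu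
  have hcont : Continuous u := continuous_mittagLeffler_neg_mul_rpow hβ one_pos 1
  have hI : ∀ t, 0 < t → 0 ≤ ∫ s in (0 : ℝ)..t, u s := fun t ht => by
    have h := rlIntegral_mittagLeffler_sub_one hβ hβ1 1 ht
    have h1 : rlIntegral (1 - β) (fun s => mittagLeffler β 1 (-1 * s ^ β) - 1) t ≤ 0 := by
      rw [rlIntegral]
      split_ifs with h0
      · linarith [mittagLeffler_neg_rpow_le_one hβ hβ1 ht.le]
      · have hβ1' : 0 < 1 - β := lt_of_le_of_ne (by linarith) (Ne.symm h0)
        have hG := Real.Gamma_pos_of_pos hβ1'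
        refine mul_nonpos_of_nonneg_of_nonpos (by positivity) ?_
        rw [← neg_nonneg, ← intervalIntegral.integral_neg]
        refine intervalIntegral.integral_nonneg ht.le fun s hs => neg_nonneg.2 ?_
        refine mul_nonpos_of_nonneg_of_nonpos (Real.rpow_nonneg (by linarith [hs.2]) _) ?_
        linarith [mittagLeffler_neg_rpow_le_one hβ hβ1 hs.1]
    rw [h] at h1
    linarith
  set c := -u t₁ with hc
  have hc0 : 0 < c := by simp only [hc, hu]; linarith
  -- Chosen so that `(T - t₁) c = t₁ + 1`: the interval `[0, t₁]` contributes at most `t₁`, hence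
  -- the integral over `[0, T]` is at most `-1`.
  set T := t₁ + (t₁ + 1) / c with hT
  have hTt : 0 < (t₁ + 1) / c := by positivity
  have h1 : ∫ s in (0 : ℝ)..t₁, u s ≤ ∫ _ in (0 : ℝ)..t₁, (1 : ℝ) :=
    intervalIntegral.integral_mono_on ht₁ (hcont.intervalIntegrable _ _) (by simp)
      fun s hs => mittagLeffler_neg_rpow_le_one hβ hβ1 hs.1
  have h2 : ∫ s in t₁..T, u s ≤ ∫ _ in t₁..T, -c :=
    intervalIntegral.integral_mono_on (by linarith) (hcont.intervalIntegrable _ _) (by simp)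
      fun s hs => by
        rw [hc, neg_neg]
        exact antitoneOn_mittagLeffler_neg_rpow hβ hβ1 (Set.mem_Ici.2 ht₁)
          (Set.mem_Ici.2 (ht₁.trans hs.1)) hs.1
  have h3 := hI T (by linarith)
  rw [← intervalIntegral.integral_add_adjacent_intervals (hcont.intervalIntegrable _ t₁)
    (hcont.intervalIntegrable _ _)] at h3
  rw [intervalIntegral.integral_const] at h1 h2
  have h4 : (T - t₁) * c = t₁ + 1 := by rw [hT]; field_simp; ring
  simp only [smul_eq_mul] at h1 h2
  linarith

/-- Monotonicity in the Volterra form: `1 - u(t) = I^β u (t) ≥ u(t) · I^β 1 (t) = u(t) t^β /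
Γ(β+1)`. -/
lemma mittagLeffler_neg_mul_le_one {β x : ℝ} (hβ : 0 < β) (hβ1 : β ≤ 1) (hx : 0 ≤ x) :
    mittagLeffler β 1 (-x) * (1 + x / Real.Gamma (β + 1)) ≤ 1 := by
  rcases hx.eq_or_lt with rfl | hx
  · simp [mittagLeffler_zero]
  obtain ⟨t, ht, rfl⟩ := exists_rpow_eq hβ hx.le
  have ht : 0 < t := ht.lt_of_ne fun h => by
    rw [← h, Real.zero_rpow hβ.ne'] at hx
    exact lt_irrefl _ hx
  have hG := Real.Gamma_pos_of_pos hβ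
  have h1 := mittagLeffler_sub_one hβ 1 t
  rw [← rlIntegral_mlKernel hβ hβ.le one_pos 1 ht] at h1
  have h2 : mittagLeffler β 1 (-1 * t ^ β) * (t ^ β / Real.Gamma (β + 1))
      ≤ rlIntegral β (mlKernel β 1 1) t := by
    have h3 := rlIntegral_rpow (b := 1) hβ.le one_pos ht
    rw [add_sub_cancel_right] at h3
    rw [← h3, ← rlIntegral_const_mul, rlIntegral_of_pos hβ, rlIntegral_of_pos hβ]
    simp only [smul_eq_mul]
    refine mul_le_mul_of_nonneg_left ?_ (by positivity)
    refine intervalIntegral.integral_mono_on ht.le ?_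
      (intervalIntegrable_sub_rpow_mul_mlKernel hβ hβ one_pos 1 ht) fun s hs => ?_
    · have := (intervalIntegrable_sub_rpow_mul_rpow hβ one_pos ht).mul_const
        (mittagLeffler β 1 (-1 * t ^ β))
      simpa using this
    · refine mul_le_mul_of_nonneg_left ?_ (Real.rpow_nonneg (by linarith [hs.2]) _)
      rw [mlKernel_one]
      simpa using antitoneOn_mittagLeffler_neg_rpow hβ hβ1 (Set.mem_Ici.2 hs.1)
          (Set.mem_Ici.2 ht.le) hs.2
  rw [neg_one_mul] at h1 h2
  linarith

/-! ### Riemann-Liouville integrals of vector-valued functions -/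

section VectorValued

variable {E : Type*} [NormedAddCommGroup E] [NormedSpace ℝ E]

lemma intervalIntegrable_sub_rpow_smul {a t : ℝ} (ha : 0 < a) (ht : 0 ≤ t) {f : ℝ → E}
    (hf : ContinuousOn f (Set.Icc 0 t)) :
    IntervalIntegrable (fun s => (t - s) ^ (a - 1) • f s) volume 0 t := by
  rcases ht.eq_or_lt with rfl | ht
  · simp
  have h := intervalIntegrable_sub_rpow_mul_rpow ha one_pos ht
  simp only [sub_self, Real.rpow_zero, mul_one] at h
  exact h.smul_continuousOn (by rwa [Set.uIcc_of_le ht.le])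

lemma rlIntegral_comp_clm {F : Type*} [NormedAddCommGroup F] [NormedSpace ℝ F] [CompleteSpace E]
    [CompleteSpace F] {α t : ℝ} (hα : 0 ≤ α) (ht : 0 ≤ t) (T : E →L[ℝ] F) {f : ℝ → E}
    (hf : ContinuousOn f (Set.Icc 0 t)) :
    rlIntegral α (fun s => T (f s)) t = T (rlIntegral α f t) := by
  rcases hα.eq_or_lt with rfl | hα
  · simp [rlIntegral]
  rw [rlIntegral_of_pos hα, rlIntegral_of_pos hα, map_smul,
    ← T.intervalIntegral_comp_comm (intervalIntegrable_sub_rpow_smul hα ht hf)]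
  simp only [map_smul]

lemma HasCaputoDerivAt.comp_clm {F : Type*} [NormedAddCommGroup F] [NormedSpace ℝ F]
    [CompleteSpace E] [CompleteSpace F] {β t : ℝ} (hβ1 : β ≤ 1) (ht : 0 < t) (T : E →L[ℝ] F)
    {w : ℝ → E} {v : E} (hw : ContinuousOn w (Set.Ici 0)) (h : HasCaputoDerivAt β w v t) :
    HasCaputoDerivAt β (fun s => T (w s)) (T v) t := by
  have h1 := T.hasFDerivAt.comp_hasDerivAt t h
  refine h1.congr_of_eventuallyEq ?_
  filter_upwards [lt_mem_nhds ht] with r hr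
  have h2 := rlIntegral_comp_clm (α := 1 - β) (by linarith) hr.le T (f := fun s => w s - w 0)
    ((hw.mono Set.Icc_subset_Ici_self).sub continuousOn_const)
  have h3 : (fun s => T (w s - w 0)) = fun s => T (w s) - T (w 0) := funext fun s => map_sub T _ _
  rw [h3] at h2
  exact h2

lemma norm_rlIntegral_le {α t : ℝ} (hα : 0 < α) (ht : 0 ≤ t) {f : ℝ → E} {g : ℝ → ℝ}
    (hg : IntervalIntegrable (fun s => (t - s) ^ (α - 1) * g s) volume 0 t)
    (h : ∀ s, 0 < s → s ≤ t → ‖f s‖ ≤ g s) : ‖rlIntegral α f t‖ ≤ rlIntegral α g t := by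
  have hG := Real.Gamma_pos_of_pos hα
  rw [rlIntegral_of_pos hα, rlIntegral_of_pos hα, norm_smul, norm_inv, Real.norm_eq_abs,
    abs_of_pos hG]
  refine mul_le_mul_of_nonneg_left ?_ (by positivity)
  refine intervalIntegral.norm_integral_le_of_norm_le ht (Eventually.of_forall fun s hs => ?_) hg
  have h0 : 0 ≤ (t - s) ^ (α - 1) := Real.rpow_nonneg (by linarith [hs.2]) _
  rw [norm_smul, Real.norm_eq_abs, abs_of_nonneg h0]
  exact mul_le_mul_of_nonneg_left (h s hs.1 hs.2) h0

/-- The kernel of the composition of two Riemann-Liouville integrals. -/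
lemma integrable_rlKernel {a b t : ℝ} (ha : 0 < a) (hb : 0 < b) (ht : 0 < t) :
    Integrable (Function.uncurry fun s r : ℝ =>
      Set.indicator {x | x ≤ s} (fun x => (t - s) ^ (a - 1) * (s - x) ^ (b - 1)) r)
      ((volume.restrict (Set.Ioc 0 t)).prod (volume.restrict (Set.Ioc 0 t))) := by
  set K : ℝ → ℝ → ℝ := fun s r =>
    Set.indicator {x | x ≤ s} (fun x => (t - s) ^ (a - 1) * (s - x) ^ (b - 1)) r with hK
  have hmeas : Measurable (Function.uncurry K) := by
    have : Function.uncurry K = Set.indicator {p : ℝ × ℝ | p.2 ≤ p.1}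
        fun p => (t - p.1) ^ (a - 1) * (p.1 - p.2) ^ (b - 1) := by
      funext p
      simp only [Function.uncurry, hK, Set.indicator, Set.mem_ofPred_eq]
    rw [this]
    exact Measurable.indicator (by fun_prop) (measurableSet_le measurable_snd measurable_fst)
  -- The inner integral of the norm is again a beta integrand in `s`, with exponent `b + 1`, so
  -- Tonelli's criterion applies.
  have hKs : ∀ s, 0 < s → s ≤ t → IntervalIntegrable (K s) volume 0 t ∧
      ∫ r in (0 : ℝ)..t, ‖K s r‖ = (t - s) ^ (a - 1) * (s ^ b / b) := by
    intro s hs hst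
    have hi := intervalIntegrable_sub_rpow_mul_rpow hb one_pos hs
    simp only [sub_self, Real.rpow_zero, mul_one] at hi
    have hv := integral_sub_rpow_mul_rpow hb one_pos hs
    simp only [sub_self, Real.rpow_zero, mul_one, Real.Gamma_one, add_sub_cancel_right] at hv
    rw [Real.Gamma_add_one hb.ne'] at hv
    have hG := (Real.Gamma_pos_of_pos hb).ne'
    have h1 : ∀ r, r ∈ Set.Icc 0 t → ‖K s r‖
        = Set.indicator {x | x ≤ s} (fun x => (t - s) ^ (a - 1) * (s - x) ^ (b - 1)) r := by
      intro r hr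
      refine Real.norm_of_nonneg (Set.indicator_nonneg (fun x hx => ?_) r)
      exact mul_nonneg (Real.rpow_nonneg (by linarith) _)
        (Real.rpow_nonneg (sub_nonneg.2 hx) _)
    refine ⟨?_, ?_⟩
    · rw [intervalIntegrable_iff_integrableOn_Ioc_of_le ht.le]
      have h2 : IntegrableOn (K s) (Set.Ioc 0 t ∩ {x | x ≤ s}) := by
        have h3 : Set.Ioc 0 t ∩ {x | x ≤ s} = Set.Ioc 0 s := by
          ext x
          simp only [Set.mem_inter_iff, Set.mem_Ioc, Set.mem_ofPred_eq]
          constructor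
          · rintro ⟨⟨h1, -⟩, h2⟩
            exact ⟨h1, h2⟩
          · rintro ⟨h1, h2⟩
            exact ⟨⟨h1, h2.trans hst⟩, h2⟩
        rw [h3]
        refine ((intervalIntegrable_iff_integrableOn_Ioc_of_le hs.le).1
          (hi.const_mul ((t - s) ^ (a - 1)))).congr_fun (fun x hx => ?_) measurableSet_Ioc
        simp only [hK]
        rw [Set.indicator_of_mem (show x ∈ {x | x ≤ s} from hx.2)]
      have h4 := (integrable_indicator_iff (measurableSet_Iic (a := s))).2
        (show IntegrableOn (K s) (Set.Iic s) (volume.restrict (Set.Ioc 0 t)) by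
          rwa [IntegrableOn, Measure.restrict_restrict measurableSet_Iic, Set.inter_comm])
      refine h4.congr (Eventually.of_forall fun x => ?_)
      simp only [hK, Set.indicator]
      by_cases hx : x ≤ s <;> simp [hx]
    · rw [intervalIntegral.integral_congr (g := fun r => Set.indicator {x | x ≤ s}
          (fun x => (t - s) ^ (a - 1) * (s - x) ^ (b - 1)) r)
          (fun r hr => h1 r (by rwa [Set.uIcc_of_le ht.le] at hr)),
        intervalIntegral.integral_indicator ⟨hs.le, hst⟩,
        intervalIntegral.integral_const_mul, hv]
      congr 1
      field_simp
  rw [integrable_prod_iff hmeas.aestronglyMeasurable]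
  constructor
  · filter_upwards [ae_restrict_mem measurableSet_Ioc] with s hs
    exact (intervalIntegrable_iff_integrableOn_Ioc_of_le ht.le).1 (hKs s hs.1 hs.2).1
  · have h1 := (intervalIntegrable_iff_integrableOn_Ioc_of_le ht.le).1
      (intervalIntegrable_sub_rpow_mul_rpow ha (b := b + 1) (by linarith) ht)
    refine (h1.mul_const b⁻¹).congr ?_
    filter_upwards [ae_restrict_mem measurableSet_Ioc] with s hs
    have h2 := (hKs s hs.1 hs.2).2
    rw [intervalIntegral.integral_of_le ht.le] at h2
    refine Eq.trans ?_ h2.symm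
    rw [add_sub_cancel_right]
    ring

lemma integral_rlKernel {a b r t : ℝ} (ha : 0 < a) (hb : 0 < b) (hr : r < t) :
    ∫ s in r..t, (t - s) ^ (a - 1) * (s - r) ^ (b - 1)
      = (t - r) ^ (a + b - 1) * (Real.Gamma a * Real.Gamma b / Real.Gamma (a + b)) := by
  have h := integral_sub_rpow_mul_rpow ha hb (sub_pos.2 hr)
  have h1 := intervalIntegral.integral_comp_sub_right (a := r) (b := t)
    (fun s => (t - r - s) ^ (a - 1) * s ^ (b - 1)) r
  rw [sub_self, h] at h1
  rw [← h1]
  refine intervalIntegral.integral_congr fun s _ => ?_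
  rw [show t - r - (s - r) = t - s by ring]

/-- Fubini on the triangle `r ≤ s ≤ t`, written as a square with an indicator; the integral in `s`
is then a translated beta integral. -/
lemma rlIntegral_rlIntegral [CompleteSpace E] {a b t : ℝ} (ha : 0 < a) (hb : 0 < b) (ht : 0 < t)
    {f : ℝ → E} (hf : Continuous f) :
    rlIntegral a (rlIntegral b f) t = rlIntegral (a + b) f t := by
  set K : ℝ → ℝ → ℝ := fun s r =>
    Set.indicator {x | x ≤ s} (fun x => (t - s) ^ (a - 1) * (s - x) ^ (b - 1)) r with hK
  have hKint := integrable_rlKernel ha hb ht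
  obtain ⟨M, hM⟩ := isCompact_Icc.exists_bound_of_continuousOn (hf.continuousOn (s := Set.Icc 0 t))
  have hFint : Integrable (Function.uncurry fun s r => K s r • f r)
      ((volume.restrict (Set.Ioc 0 t)).prod (volume.restrict (Set.Ioc 0 t))) := by
    refine Integrable.mono' (hKint.norm.mul_const M) (hKint.aestronglyMeasurable.smul
      (hf.comp continuous_snd).aestronglyMeasurable) ?_
    rw [Measure.prod_restrict]
    filter_upwards [ae_restrict_mem (measurableSet_Ioc.prod measurableSet_Ioc)] with p hp
    simp only [Function.uncurry, norm_smul]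
    exact mul_le_mul_of_nonneg_left (hM _ (Set.Ioc_subset_Icc_self hp.2)) (norm_nonneg _)
  have hswap := intervalIntegral_intervalIntegral_swap (a := 0) (b := t) (c := 0) (d := t)
    (F := fun s r => K s r • f r) (by
      rw [Set.uIoc_of_le ht.le, IntegrableOn, Measure.volume_eq_prod, ← Measure.prod_restrict]
      exact hFint)
  have hL : ∫ s in (0 : ℝ)..t, ∫ r in (0 : ℝ)..t, K s r • f r
      = ∫ s in (0 : ℝ)..t, (t - s) ^ (a - 1) • ∫ r in (0 : ℝ)..s, (s - r) ^ (b - 1) • f r := by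
    refine intervalIntegral.integral_congr fun s hs => ?_
    rw [Set.uIcc_of_le ht.le] at hs
    have h1 : ∀ r, K s r • f r = Set.indicator {x | x ≤ s}
        (fun x => (t - s) ^ (a - 1) • ((s - x) ^ (b - 1) • f x)) r := fun r => by
      simp only [hK, Set.indicator, Set.mem_ofPred_eq]
      split_ifs
      · rw [mul_smul]
      · rw [zero_smul]
    simp only [h1]
    rw [intervalIntegral.integral_indicator hs, intervalIntegral.integral_smul]
  have hR : ∫ r in (0 : ℝ)..t, ∫ s in (0 : ℝ)..t, K s r • f r
      = (Real.Gamma a * Real.Gamma b / Real.Gamma (a + b)) •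
        ∫ r in (0 : ℝ)..t, (t - r) ^ (a + b - 1) • f r := by
    -- The endpoint `r = t` is discarded, since the translated beta integral requires `r < t`.
    rw [← intervalIntegral.integral_smul, intervalIntegral.integral_of_le ht.le,
      intervalIntegral.integral_of_le ht.le, integral_Ioc_eq_integral_Ioo,
      integral_Ioc_eq_integral_Ioo]
    refine setIntegral_congr_fun measurableSet_Ioo fun r hr => ?_
    have h1 : ∀ s, K s r • f r = (Set.Ici r).indicator
        (fun s => ((t - s) ^ (a - 1) * (s - r) ^ (b - 1)) • f r) s := fun s => by
      simp only [hK, Set.indicator, Set.mem_ofPred_eq, Set.mem_Ici]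
      split_ifs
      · rfl
      · rw [zero_smul]
    simp only [h1]
    have h2 : Set.Ioc 0 t ∩ Set.Ici r = Set.Icc r t := by
      ext x
      simp only [Set.mem_inter_iff, Set.mem_Ioc, Set.mem_Ici, Set.mem_Icc]
      constructor
      · rintro ⟨⟨-, h1⟩, h2⟩
        exact ⟨h2, h1⟩
      · rintro ⟨h1, h2⟩
        exact ⟨⟨hr.1.trans_le h1, h2⟩, h1⟩
    rw [intervalIntegral.integral_of_le ht.le, setIntegral_indicator measurableSet_Ici, h2,
      integral_Icc_eq_integral_Ioc, ← intervalIntegral.integral_of_le hr.2.le,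
      intervalIntegral.integral_smul_const, integral_rlKernel ha hb hr.2, smul_smul, mul_comm]
  rw [hL, hR] at hswap
  have hGa := Real.Gamma_pos_of_pos ha
  have hGb := Real.Gamma_pos_of_pos hb
  have hab : 0 < a + b := add_pos ha hb
  rw [rlIntegral_of_pos ha, rlIntegral_of_pos hab]
  simp only [rlIntegral_of_pos hb, smul_comm _ (Real.Gamma b)⁻¹]
  rw [intervalIntegral.integral_smul, hswap, smul_smul, smul_smul]
  congr 1
  field_simp

/-! ### Uniqueness for the scalar equation -/

/-- Feeding a bound for `Z` back into the equation `n` times gives `‖Z t‖ ≤ M |lam|^n t^(β n) / Γ(β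
n + 1)`, a term of a convergent Mittag-Leffler series. -/
lemma eq_zero_of_eq_smul_rlIntegral {β : ℝ} (hβ : 0 < β) (lam : ℝ) {Z : ℝ → E}
    (hZ : Continuous Z) (h : ∀ t, 0 < t → Z t = lam • rlIntegral β Z t) {T : ℝ} (hT : 0 < T) :
    Z T = 0 := by
  obtain ⟨M, hM⟩ := isCompact_Icc.exists_bound_of_continuousOn (hZ.continuousOn (s := Set.Icc 0 T))
  have hbound : ∀ (n : ℕ) (t : ℝ), 0 < t → t ≤ T →
      ‖Z t‖ ≤ (M * |lam| ^ n) * (t ^ (β * n + 1 - 1) / Real.Gamma (β * n + 1)) := by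
    intro n
    induction n with
    | zero =>
      intro t ht htT
      simpa using hM t ⟨ht.le, htT⟩
    | succ n ih =>
      intro t ht htT
      have hn : 0 < β * n + 1 := by positivity
      have h1 := norm_rlIntegral_le hβ ht.le (f := Z)
        (g := fun s => (M * |lam| ^ n) * (s ^ (β * n + 1 - 1) / Real.Gamma (β * n + 1)))
        (by
          refine ((intervalIntegrable_sub_rpow_mul_rpow hβ hn ht).const_mul
            (M * |lam| ^ n / Real.Gamma (β * n + 1))).congr (fun s _ => ?_)
          ring)
        fun s hs hst => ih s hs (hst.trans htT)
      rw [rlIntegral_const_mul, rlIntegral_rpow hβ.le hn ht] at h1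
      rw [h t ht, norm_smul, Real.norm_eq_abs]
      calc |lam| * ‖rlIntegral β Z t‖ ≤ |lam| * (M * |lam| ^ n *
            (t ^ (β + (β * n + 1) - 1) / Real.Gamma (β + (β * n + 1)))) := by gcongr
        _ = _ := by
          rw [show β * ((n + 1 : ℕ) : ℝ) + 1 = β + (β * n + 1) by push_cast; ring]
          ring
  have hlim : Tendsto (fun n : ℕ =>
      (M * |lam| ^ n) * (T ^ (β * n + 1 - 1) / Real.Gamma (β * n + 1))) atTop (𝓝 0) := by
    have h1 := ((hasSum_mlKernel hβ one_pos (-|lam|) hT).summable.mul_left M).tendsto_atTop_zero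
    simpa [mul_assoc] using h1
  exact norm_le_zero_iff.1 (ge_of_tendsto' hlim fun n => hbound n T hT le_rfl)

/-- For `α > 0` the integral is `O(t^α)` by boundedness of `z` alone; `z 0 = 0` matters for `α = 0`.
-/
lemma tendsto_rlIntegral_zero {α : ℝ} (hα : 0 ≤ α) {z : ℝ → E} (hz : Continuous z) (h0 : z 0 = 0) :
    Tendsto (rlIntegral α z) (𝓝[>] 0) (𝓝 0) := by
  rcases hα.eq_or_lt with rfl | hα
  · have := hz.tendsto 0
    rw [h0] at this
    refine (this.mono_left nhdsWithin_le_nhds).congr fun t => ?_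
    simp [rlIntegral]
  obtain ⟨M, hM⟩ := isCompact_Icc.exists_bound_of_continuousOn (hz.continuousOn (s := Set.Icc 0 1))
  have hlim : Tendsto (fun t : ℝ => M * (t ^ α / Real.Gamma (α + 1))) (𝓝[>] 0) (𝓝 0) := by
    have := (Real.continuous_rpow_const (q := α) hα.le).tendsto 0
    rw [Real.zero_rpow hα.ne'] at this
    simpa using ((this.mono_left nhdsWithin_le_nhds).div_const (Real.Gamma (α + 1))).const_mul M
  refine squeeze_zero_norm' ?_ hlim
  filter_upwards [Ioo_mem_nhdsGT one_pos] with t ht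
  have h1 := norm_rlIntegral_le hα ht.1.le (f := z)
    (g := fun s => M * (s ^ ((1 : ℝ) - 1) / Real.Gamma 1))
    (by
      have := (intervalIntegrable_sub_rpow_mul_rpow hα one_pos ht.1).mul_const M
      simpa using this)
    fun s hs hst => by simpa using hM s ⟨hs.le, hst.trans ht.2.le⟩
  rwa [rlIntegral_const_mul, rlIntegral_rpow hα.le one_pos ht.1, add_sub_cancel_right] at h1

/-- Let `Z` be the primitive of `z`. The function `I^(1-β) z - lam Z` has zero derivative on `(0,
∞)` and limit `0` at `0`, so it vanishes. Applying `I^β` turns `I^(1-β) z = lam Z` into `Z = lam I^β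
Z`, whence `Z = 0` and `z = Z' = 0`. -/
lemma eq_zero_of_hasDerivAt_rlIntegral [CompleteSpace E] {β : ℝ} (hβ : 0 < β) (hβ1 : β ≤ 1)
    (lam : ℝ) {z : ℝ → E} (hz : Continuous z) (h0 : z 0 = 0)
    (h : ∀ t, 0 < t → HasDerivAt (rlIntegral (1 - β) z) (lam • z t) t) {T : ℝ} (hT : 0 < T) :
    z T = 0 := by
  set Z : ℝ → E := fun t => ∫ s in (0 : ℝ)..t, z s with hZ
  have hZd : ∀ t, HasDerivAt Z (z t) t := fun t => hz.integral_hasStrictDerivAt 0 t |>.hasDerivAt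
  have hZc : Continuous Z := continuous_iff_continuousAt.2 fun t => (hZd t).continuousAt
  have hZ0 : Z 0 = 0 := by simp [hZ]
  have hG : ∀ t, 0 < t → HasDerivAt (rlIntegral (1 - β) z - lam • Z) 0 t :=
    fun t ht => by simpa using (h t ht).sub ((hZd t).const_smul lam)
  obtain ⟨c, hc⟩ := isOpen_Ioi.exists_is_const_of_deriv_eq_zero (s := Set.Ioi (0 : ℝ))
    isPreconnected_Ioi (fun t ht => (hG t ht).differentiableAt.differentiableWithinAt)
    fun t ht => (hG t ht).deriv
  have hc0 : c = 0 := by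
    have h1 : Tendsto (fun t => rlIntegral (1 - β) z t - lam • Z t) (𝓝[>] 0) (𝓝 0) := by
      have h2 := hZc.tendsto 0
      rw [hZ0] at h2
      simpa using (tendsto_rlIntegral_zero (α := 1 - β) (by linarith) hz h0).sub
        ((h2.mono_left nhdsWithin_le_nhds).const_smul lam)
    refine tendsto_nhds_unique (tendsto_const_nhds.congr' ?_) h1
    filter_upwards [self_mem_nhdsWithin] with t ht
    exact (hc t ht).symm
  have heq : ∀ t, 0 ≤ t → rlIntegral (1 - β) z t = lam • Z t := fun t ht => by
    rcases ht.eq_or_lt with rfl | ht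
    · rw [hZ0, smul_zero, rlIntegral]
      split_ifs
      · exact h0
      · simp
    · exact sub_eq_zero.1 ((hc t ht).trans hc0)
  have hvol : ∀ t, 0 < t → Z t = lam • rlIntegral β Z t := fun t ht => by
    have h1 : rlIntegral β (rlIntegral (1 - β) z) t = Z t := by
      rcases hβ1.eq_or_lt with rfl | hlt
      · rw [rlIntegral_one]
        simp [rlIntegral, hZ]
      · rw [rlIntegral_rlIntegral hβ (by linarith) ht hz, add_sub_cancel, rlIntegral_one]
    rw [← h1, rlIntegral_congr ht.le fun s hs _ => heq s hs, rlIntegral_of_pos hβ,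
      rlIntegral_of_pos hβ]
    simp only [smul_comm _ lam]
    rw [intervalIntegral.integral_smul, smul_comm lam]
  have hZz : ∀ t, 0 < t → Z t = 0 := fun t ht => eq_zero_of_eq_smul_rlIntegral hβ lam hZc hvol ht
  refine (hZd T).unique ((hasDerivAt_const T (0 : E)).congr_of_eventuallyEq ?_)
  filter_upwards [lt_mem_nhds hT] with t ht
  exact hZz t ht

lemma eq_zero_of_caputo_eq [CompleteSpace E] {β : ℝ} (hβ : 0 < β) (hβ1 : β ≤ 1)
    (lam : ℝ) {z : ℝ → E} (hz : ContinuousOn z (Set.Ici 0)) (h0 : z 0 = 0)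
    (h : ∀ t, 0 < t → HasCaputoDerivAt β z (lam • z t) t) {T : ℝ} (hT : 0 ≤ T) :
    z T = 0 := by
  rcases hT.eq_or_lt with rfl | hT
  · exact h0
  -- Extending `z` to the left by the constant `z 0` makes it continuous on the line without
  -- changing integrals from `0`.
  have hz' : Continuous fun s => z (max s 0) :=
    hz.comp_continuous (by fun_prop) fun s => le_max_right s 0
  have h1 := eq_zero_of_hasDerivAt_rlIntegral hβ hβ1 lam hz' (by simpa using h0)
    (fun t ht => ?_) hT
  · simpa [max_eq_left hT.le] using h1
  rw [max_eq_left ht.le]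
  refine (h t ht).congr_of_eventuallyEq ?_
  filter_upwards [lt_mem_nhds ht] with r hr
  refine rlIntegral_congr hr.le fun s hs _ => ?_
  rw [max_eq_left hs, h0, sub_zero]

end VectorValued

/-! ### Multipliers in `ℓ²` -/

section L2

variable {𝕜 ι : Type*} [RCLike 𝕜]

lemma lp_two_norm_sq (f : lp (fun _ : ι => 𝕜) 2) : ‖f‖ ^ 2 = ∑' ζ, ‖f ζ‖ ^ 2 := by
  have h := lp.norm_rpow_eq_tsum (p := 2) (by norm_num) f
  simpa using h

lemma lp_two_summable (f : lp (fun _ : ι => 𝕜) 2) : Summable fun ζ => ‖f ζ‖ ^ 2 := by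
  simpa using (lp.memℓp f).summable (by norm_num)

lemma exists_lp_two_mul {m : ι → ℝ} {K : ℝ} (hm : ∀ ζ, |m ζ| ≤ K)
    (c : lp (fun _ : ι => 𝕜) 2) :
    ∃ d : lp (fun _ : ι => 𝕜) 2, (∀ ζ, d ζ = (m ζ : 𝕜) * c ζ) ∧ ‖d‖ ≤ |K| * ‖c‖ := by
  have hle : ∀ ζ, ‖(m ζ : 𝕜) * c ζ‖ ^ 2 ≤ K ^ 2 * ‖c ζ‖ ^ 2 := fun ζ => by
    rw [norm_mul, RCLike.norm_ofReal, mul_pow]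
    have := pow_le_pow_left₀ (abs_nonneg _) (hm ζ) 2
    gcongr
  have hs : Summable fun ζ => ‖(m ζ : 𝕜) * c ζ‖ ^ 2 :=
    Summable.of_nonneg_of_le (fun ζ => by positivity) hle ((lp_two_summable c).mul_left _)
  refine ⟨⟨fun ζ => (m ζ : 𝕜) * c ζ, memℓp_gen (by simpa using hs)⟩, fun ζ => rfl, ?_⟩
  refine (sq_le_sq₀ (norm_nonneg _) (by positivity)).1 ?_
  rw [lp_two_norm_sq, mul_pow, lp_two_norm_sq, sq_abs, ← tsum_mul_left]
  exact hs.tsum_le_tsum hle ((lp_two_summable c).mul_left _)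

/-- Dominated convergence for the series of `‖f r - f t‖²`, with majorant `(2K)² ‖c ζ‖²`. -/
lemma continuousWithinAt_lp_two_mul {m : ι → ℝ → ℝ} {K : ℝ} {s : Set ℝ} {t : ℝ} (ht : t ∈ s)
    (hm : ∀ ζ, ∀ r ∈ s, |m ζ r| ≤ K) (hc : ∀ ζ, ContinuousWithinAt (m ζ) s t)
    (c : lp (fun _ : ι => 𝕜) 2) {f : ℝ → lp (fun _ : ι => 𝕜) 2}
    (hf : ∀ r ∈ s, ∀ ζ, f r ζ = (m ζ r : 𝕜) * c ζ) : ContinuousWithinAt f s t := by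
  rw [ContinuousWithinAt, tendsto_iff_norm_sub_tendsto_zero]
  have h1 : Tendsto (fun r => ∑' ζ, ‖f r ζ - f t ζ‖ ^ 2) (𝓝[s] t) (𝓝 (∑' _ : ι, (0 : ℝ))) := by
    refine tendsto_tsum_of_dominated_convergence
      ((lp_two_summable c).mul_left ((2 * K) ^ 2)) (fun ζ => ?_) ?_
    · have h2 : Tendsto (fun r => ‖(m ζ r : 𝕜) * c ζ - (m ζ t : 𝕜) * c ζ‖ ^ 2) (𝓝[s] t)
          (𝓝 (‖(m ζ t : 𝕜) * c ζ - (m ζ t : 𝕜) * c ζ‖ ^ 2)) :=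
        (((((RCLike.continuous_ofReal.tendsto _).comp (hc ζ)).mul_const _).sub_const _).norm).pow 2
      rw [sub_self, norm_zero, zero_pow two_ne_zero] at h2
      refine h2.congr' ?_
      filter_upwards [self_mem_nhdsWithin] with r hr
      rw [hf r hr, hf t ht]
    · filter_upwards [self_mem_nhdsWithin] with r hr ζ
      have h2 : |m ζ r - m ζ t| ≤ 2 * K := by
        have := abs_sub (m ζ r) (m ζ t)
        linarith [hm ζ r hr, hm ζ t ht]
      have h3 := pow_le_pow_left₀ (abs_nonneg _) h2 2
      rw [hf r hr, hf t ht, ← sub_mul, ← RCLike.ofReal_sub, norm_mul, RCLike.norm_ofReal,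
        Real.norm_of_nonneg (by positivity), mul_pow]
      gcongr
  rw [tsum_zero] at h1
  have h2 := h1.sqrt
  rw [Real.sqrt_zero] at h2
  refine h2.congr fun r => ?_
  have h3 := lp_two_norm_sq (f r - f t)
  simp only [lp.coeFn_sub, Pi.sub_apply] at h3
  rw [← h3, Real.sqrt_sq (norm_nonneg _)]

end L2

/-! ### The scalar solution -/

lemma mul_mittagLeffler_neg_le {β x : ℝ} (hβ : 0 < β) (hβ1 : β ≤ 1) (hx : 0 ≤ x) :
    x * mittagLeffler β 1 (-x) ≤ Real.Gamma (β + 1) := by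
  have hG := Real.Gamma_pos_of_pos (s := β + 1) (by linarith)
  have h := mittagLeffler_neg_mul_le_one hβ hβ1 hx
  have h0 := mittagLeffler_neg_nonneg hβ hβ1 hx
  have h1 : mittagLeffler β 1 (-x) * (x / Real.Gamma (β + 1)) ≤ 1 := by linarith
  rw [← mul_div_assoc, div_le_one hG] at h1
  linarith

lemma abs_mittagLeffler_neg_le_one {β lam t : ℝ} (hβ : 0 < β) (hβ1 : β ≤ 1) (hlam : 0 ≤ lam)
    (ht : 0 ≤ t) : |mittagLeffler β 1 (-lam * t ^ β)| ≤ 1 := by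
  have hx : 0 ≤ lam * t ^ β := mul_nonneg hlam (Real.rpow_nonneg ht _)
  rw [neg_mul, abs_of_nonneg (mittagLeffler_neg_nonneg hβ hβ1 hx)]
  exact mittagLeffler_neg_le_one hβ hβ1 hx

/-- With `x = lam t^β` this is boundedness of `x E_β(-x)`. Uniformity in `lam` is what gains a full
power of `L`, at the price of `t^(-β)`. -/
lemma abs_mul_mittagLeffler_neg_le {β lam t : ℝ} (hβ : 0 < β) (hβ1 : β ≤ 1) (hlam : 0 ≤ lam)
    (ht : 0 < t) :
    |lam * mittagLeffler β 1 (-lam * t ^ β)| ≤ Real.Gamma (β + 1) * t ^ (-β) := by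
  have htβ : 0 < t ^ β := Real.rpow_pos_of_pos ht _
  have hx : 0 ≤ lam * t ^ β := mul_nonneg hlam htβ.le
  have h0 := mittagLeffler_neg_nonneg hβ hβ1 hx
  rw [neg_mul, abs_of_nonneg (mul_nonneg hlam h0), Real.rpow_neg ht.le, ← div_eq_mul_inv,
    le_div_iff₀ htβ]
  linarith [mul_mittagLeffler_neg_le hβ hβ1 hx]

/-- The shift `b = 0` serves `L w`, and `b = 1` the passage from `H^(δ-2)` to `H^δ`. -/
lemma abs_add_mul_mittagLeffler_neg_le {β lam t : ℝ} (hβ : 0 < β) (hβ1 : β ≤ 1) (hlam : 0 ≤ lam)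
    (ht : 0 < t) (b : ℝ) :
    |(b + lam) * mittagLeffler β 1 (-lam * t ^ β)| ≤ |b| + Real.Gamma (β + 1) * t ^ (-β) := by
  rw [add_mul]
  refine (abs_add_le _ _).trans (add_le_add ?_ (abs_mul_mittagLeffler_neg_le hβ hβ1 hlam ht))
  rw [abs_mul]
  exact mul_le_of_le_one_right (abs_nonneg b) (abs_mittagLeffler_neg_le_one hβ hβ1 hlam ht.le)

lemma mittagLeffler_neg_mul_zero_rpow {β : ℝ} (hβ : 0 < β) (lam : ℝ) :
    mittagLeffler β 1 (-lam * (0 : ℝ) ^ β) = 1 := by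
  simp [Real.zero_rpow hβ.ne', mittagLeffler_zero]

lemma hasCaputoDerivAt_mittagLeffler {β t : ℝ} (hβ : 0 < β) (hβ1 : β ≤ 1) (lam : ℝ) (ht : 0 < t) :
    HasCaputoDerivAt β (fun s => mittagLeffler β 1 (-lam * s ^ β))
      (-lam * mittagLeffler β 1 (-lam * t ^ β)) t := by
  have h := (((continuous_mittagLeffler_neg_mul_rpow hβ one_pos lam).integral_hasStrictDerivAt
    0 t).hasDerivAt).const_mul (-lam)
  refine h.congr_of_eventuallyEq ?_
  filter_upwards [lt_mem_nhds ht] with r hr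
  rw [← rlIntegral_mittagLeffler_sub_one hβ hβ1 lam hr, mittagLeffler_neg_mul_zero_rpow hβ]

lemma HasCaputoDerivAt.sub {E : Type*} [NormedAddCommGroup E] [NormedSpace ℝ E] {β t : ℝ}
    (hβ1 : β ≤ 1) (ht : 0 < t) {f g : ℝ → E} {f' g' : E} (hf : ContinuousOn f (Set.Ici 0))
    (hg : ContinuousOn g (Set.Ici 0)) (hf' : HasCaputoDerivAt β f f' t)
    (hg' : HasCaputoDerivAt β g g' t) : HasCaputoDerivAt β (fun s => f s - g s) (f' - g') t := by
  refine (HasDerivAt.sub hf' hg').congr_of_eventuallyEq ?_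
  filter_upwards [lt_mem_nhds ht] with r hr
  rw [Pi.sub_apply, rlIntegral, rlIntegral, rlIntegral]
  split_ifs with h
  · abel
  · have h1 : 0 < 1 - β := lt_of_le_of_ne (by linarith) (Ne.symm h)
    rw [← smul_sub, ← intervalIntegral.integral_sub
      (intervalIntegrable_sub_rpow_smul h1 hr.le (f := fun s => f s - f 0)
        ((hf.mono Set.Icc_subset_Ici_self).sub continuousOn_const))
      (intervalIntegrable_sub_rpow_smul h1 hr.le (f := fun s => g s - g 0)
        ((hg.mono Set.Icc_subset_Ici_self).sub continuousOn_const))]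
    congr 2
    funext s
    rw [← smul_sub]
    congr 1
    abel

/-! ### Coordinates of solutions -/

section Coordinates

variable {𝕜 : Type*} [RCLike 𝕜]

/-- The difference of the two sides solves the same linear equation with initial value `0`. -/
lemma eq_mittagLeffler_of_caputo_eq {β : ℝ} (hβ : 0 < β) (hβ1 : β ≤ 1)
    (lam : ℝ) {z : ℝ → 𝕜} (hz : ContinuousOn z (Set.Ici 0))
    (h : ∀ t, 0 < t → HasCaputoDerivAt β z (-((lam : 𝕜) * z t)) t) {T : ℝ} (hT : 0 ≤ T) :
    z T = (mittagLeffler β 1 (-lam * T ^ β) : ℝ) * z 0 := by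
  set T' : ℝ →L[ℝ] 𝕜 := ContinuousLinearMap.toSpanSingleton ℝ (z 0) with hT'
  have hT'a : ∀ r, T' r = (r : 𝕜) * z 0 := fun r => by
    simp [hT', ContinuousLinearMap.toSpanSingleton_apply, RCLike.real_smul_eq_coe_mul]
  have hE := continuous_mittagLeffler_neg_mul_rpow hβ one_pos lam
  have h1 := eq_zero_of_caputo_eq hβ hβ1 (-lam)
    (z := fun s => z s - T' (mittagLeffler β 1 (-lam * s ^ β)))
    (hz.sub (T'.continuous.comp hE).continuousOn)
    (by simp only [hT'a, mittagLeffler_neg_mul_zero_rpow hβ]; simp) (fun t ht => ?_) hT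
  · rw [← hT'a]
    exact sub_eq_zero.1 h1
  have h2 := (hasCaputoDerivAt_mittagLeffler hβ hβ1 lam ht).comp_clm hβ1 ht T' hE.continuousOn
  convert! HasCaputoDerivAt.sub hβ1 ht hz (T'.continuous.comp hE).continuousOn (h t ht) h2 using 1
  simp only [hT'a, RCLike.real_smul_eq_coe_mul]
  push_cast
  ring

variable {X : Type*} [NormedAddCommGroup X] [NormedSpace 𝕜 X] [CompleteSpace X]

/-- A coordinate of a solution is a multiple of the Mittag-Leffler function. -/
lemma IsHeatSolution.coord_eq {β : ℝ} (hβ : 0 < β) (hβ1 : β ≤ 1) {A : X →ₗ.[𝕜] X} {x₀ : X}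
    {w : ℝ → X} (hw : IsHeatSolution A β x₀ w) (T : X →L[𝕜] 𝕜) (lam : ℝ)
    (hT : ∀ x : A.domain, T (A x) = (lam : 𝕜) * T x) {t : ℝ} (ht : 0 ≤ t) :
    T (w t) = (mittagLeffler β 1 (-lam * t ^ β) : ℝ) * T x₀ := by
  let _ : NormedSpace ℝ X := NormedSpace.restrictScalars ℝ 𝕜 X
  have _ : IsScalarTower ℝ 𝕜 X := RestrictScalars.isScalarTower ℝ 𝕜 X
  rw [← hw.initial]
  refine eq_mittagLeffler_of_caputo_eq hβ hβ1 lam (z := fun t => T (w t))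
    (T.continuous.comp_continuousOn hw.continuousOn) (fun r hr => ?_) ht
  obtain ⟨hd, h⟩ := hw.equation r hr
  have h1 := HasCaputoDerivAt.comp_clm hβ1 hr (T.restrictScalars ℝ) hw.continuousOn h
  simpa only [ContinuousLinearMap.coe_restrictScalars', map_neg, hT] using h1

end Coordinates

/-! ### Existence for diagonal operators -/

section Diagonal

variable {𝕜 ι X : Type*} [RCLike 𝕜] [NormedAddCommGroup X] [NormedSpace 𝕜 X]

/-- The coordinate functionals of a space which is identified with `ℓ²`. -/
def l2Coord (Φ : X ≃ₗᵢ[𝕜] lp (fun _ : ι => 𝕜) 2) (ζ : ι) : X →L[𝕜] 𝕜 :=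
  LinearMap.mkContinuous
    { toFun := fun x => Φ x ζ
      map_add' := fun x y => by simp
      map_smul' := fun c x => by simp } 1 fun x => by
    have h := lp.norm_apply_le_norm (by norm_num) (Φ x) ζ
    rwa [Φ.norm_map, ← one_mul ‖x‖] at h

lemma l2Coord_ext (Φ : X ≃ₗᵢ[𝕜] lp (fun _ : ι => 𝕜) 2) {x y : X}
    (h : ∀ ζ, l2Coord Φ ζ x = l2Coord Φ ζ y) : x = y :=
  Φ.injective (lp.ext (funext h))

variable (Φ : X ≃ₗᵢ[𝕜] lp (fun _ : ι => 𝕜) 2)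

lemma continuousOn_of_coord_mittagLeffler {γ : ι → ℝ} (hγ : ∀ ζ, 0 ≤ γ ζ) {β : ℝ} (hβ : 0 < β) (hβ1 : β ≤ 1) {x₀ : X} {w : ℝ → X}
    (hw : ∀ t, 0 ≤ t → ∀ ζ, Φ (w t) ζ = (mittagLeffler β 1 (-γ ζ * t ^ β) : ℝ) * Φ x₀ ζ) :
    ContinuousOn w (Set.Ici 0) := fun t ht => by
  have h := continuousWithinAt_lp_two_mul (m := fun ζ t => mittagLeffler β 1 (-γ ζ * t ^ β)) ht
    (fun ζ r hr => abs_mittagLeffler_neg_le_one hβ hβ1 (hγ ζ) hr)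
    (fun ζ => (continuous_mittagLeffler_neg_mul_rpow hβ one_pos (γ ζ)).continuousWithinAt)
    (Φ x₀) (f := fun r => Φ (w r)) fun r hr => hw r hr
  exact (Φ.symm.continuous.continuousAt.comp_continuousWithinAt h).congr
    (fun _ _ => by simp) (by simp)

lemma continuousOn_of_coord_mul_mittagLeffler {γ : ι → ℝ} (hγ : ∀ ζ, 0 ≤ γ ζ) {β : ℝ} (hβ : 0 < β)
    (hβ1 : β ≤ 1) (b : ℝ) {x₀ : X} {y : ℝ → X}
    (hy : ∀ t, 0 < t → ∀ ζ,
      Φ (y t) ζ = (((b + γ ζ) * mittagLeffler β 1 (-γ ζ * t ^ β) : ℝ) : 𝕜) * Φ x₀ ζ) :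
    ContinuousOn y (Set.Ioi 0) := fun t ht => by
  have ht : 0 < t := ht
  have ht2 : 0 < t / 2 := by linarith
  -- The multiplier bound blows up as `t → 0`, so it is used on `(t / 2, ∞)`; continuity at `t` is
  -- local.
  have h := continuousWithinAt_lp_two_mul (s := Set.Ioi (t / 2)) (t := t)
    (m := fun ζ t => (b + γ ζ) * mittagLeffler β 1 (-γ ζ * t ^ β)) (Set.mem_Ioi.2 (by linarith))
    (K := |b| + Real.Gamma (β + 1) * (t / 2) ^ (-β))
    (fun ζ r hr => by
      have hr : t / 2 < r := hr
      have hG := Real.Gamma_pos_of_pos (s := β + 1) (by linarith)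
      refine (abs_add_mul_mittagLeffler_neg_le hβ hβ1 (hγ ζ) (ht2.trans hr) b).trans ?_
      refine add_le_add_right (mul_le_mul_of_nonneg_left ?_ hG.le) _
      exact (Real.rpow_le_rpow_of_nonpos ht2 hr.le (by linarith)))
    (fun ζ => ((continuous_mittagLeffler_neg_mul_rpow hβ one_pos (γ ζ)).const_mul
      (b + γ ζ)).continuousWithinAt)
    (Φ x₀) (f := fun r => Φ (y r)) fun r hr => hy r (ht2.trans hr)
  have h1 : ContinuousWithinAt y (Set.Ioi (t / 2)) t := by
    exact (Φ.symm.continuous.continuousAt.comp_continuousWithinAt h).congr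
      (fun _ _ => by simp) (by simp)
  exact (h1.continuousAt (Ioi_mem_nhds (by linarith))).continuousWithinAt

/-- Coordinatewise derivatives do not by themselves give a derivative in norm. Instead `G =
I^(1-β)(w - w 0)` is shown to satisfy `G b = G a - ∫ y` over `[a, b]`, an identity in `X` that may
be tested on coordinates, and the fundamental theorem of calculus applies to the continuous `y`.
Keeping `a > 0` avoids the singularity of the bound on `y` at `0`. -/
lemma hasCaputoDerivAt_of_coord [CompleteSpace X] [NormedSpace ℝ X] [IsScalarTower ℝ 𝕜 X]
    {γ : ι → ℝ} (hγ : ∀ ζ, 0 ≤ γ ζ) {β : ℝ} (hβ : 0 < β) (hβ1 : β ≤ 1) {x₀ : X} {w y : ℝ → X}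
    (hw : ∀ t, 0 ≤ t → ∀ ζ, Φ (w t) ζ = (mittagLeffler β 1 (-γ ζ * t ^ β) : ℝ) * Φ x₀ ζ)
    (hy : ∀ t, 0 < t → ∀ ζ,
      Φ (y t) ζ = ((γ ζ * mittagLeffler β 1 (-γ ζ * t ^ β) : ℝ) : 𝕜) * Φ x₀ ζ)
    {t : ℝ} (ht : 0 < t) : HasCaputoDerivAt β w (-(y t)) t := by
  have hwc := continuousOn_of_coord_mittagLeffler Φ hγ hβ hβ1 hw
  have hyc := continuousOn_of_coord_mul_mittagLeffler Φ hγ hβ hβ1 0 (by simpa using hy)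
  set T : ι → X →L[ℝ] 𝕜 := fun ζ => (l2Coord Φ ζ).restrictScalars ℝ with hT
  set U : ι → ℝ →L[ℝ] 𝕜 := fun ζ => ContinuousLinearMap.toSpanSingleton ℝ (Φ x₀ ζ) with hU
  have hUa : ∀ ζ r, U ζ r = (r : 𝕜) * Φ x₀ ζ := fun ζ r => by
    simp [hU, ContinuousLinearMap.toSpanSingleton_apply, RCLike.real_smul_eq_coe_mul]
  have hE := fun ζ => continuous_mittagLeffler_neg_mul_rpow hβ one_pos (γ ζ)
  set G : ℝ → X := rlIntegral (1 - β) fun s => w s - w 0 with hG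
  have hGT : ∀ r, 0 < r → ∀ ζ, T ζ (G r)
      = U ζ (-γ ζ * ∫ s in (0 : ℝ)..r, mittagLeffler β 1 (-γ ζ * s ^ β)) := fun r hr ζ => by
    rw [hG, ← rlIntegral_comp_clm (by linarith) hr.le (T ζ) (f := fun s => w s - w 0)
        ((hwc.mono Set.Icc_subset_Ici_self).sub continuousOn_const),
      ← rlIntegral_mittagLeffler_sub_one hβ hβ1 (γ ζ) hr,
      ← rlIntegral_comp_clm (by linarith) hr.le (U ζ)
        (f := fun s => mittagLeffler β 1 (-γ ζ * s ^ β) - 1) ((hE ζ).sub continuous_const).continuousOn]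
    refine rlIntegral_congr hr.le fun s hs _ => ?_
    rw [map_sub, map_sub, hUa, hUa]
    change Φ (w s) ζ - Φ (w 0) ζ = _
    rw [hw s hs, hw 0 le_rfl, mittagLeffler_neg_mul_zero_rpow hβ]
  have hyi : ∀ a b, 0 < a → a ≤ b → IntervalIntegrable y volume a b := fun a b ha hab =>
    ContinuousOn.intervalIntegrable (hyc.mono (by
      rw [Set.uIcc_of_le hab]
      exact fun s hs => ha.trans_le hs.1))
  have hdiff : ∀ a b, 0 < a → a ≤ b → G b = G a - ∫ s in a..b, y s := by
    intro a b ha hab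
    refine l2Coord_ext Φ fun ζ => ?_
    change T ζ (G b) = T ζ (G a - ∫ s in a..b, y s)
    have h1 : T ζ (∫ s in a..b, y s)
        = U ζ (γ ζ * ∫ s in a..b, mittagLeffler β 1 (-γ ζ * s ^ β)) := by
      rw [← (T ζ).intervalIntegral_comp_comm (hyi a b ha hab),
        ← intervalIntegral.integral_const_mul,
        ← (U ζ).intervalIntegral_comp_comm (((hE ζ).const_mul _).intervalIntegrable _ _)]
      refine intervalIntegral.integral_congr fun s hs => ?_
      rw [Set.uIcc_of_le hab] at hs
      change Φ (y s) ζ = _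
      rw [hy s (ha.trans_le hs.1), hUa]
    rw [map_sub, hGT b (ha.trans_le hab), hGT a ha, h1, ← map_sub,
      ← intervalIntegral.integral_add_adjacent_intervals ((hE ζ).intervalIntegrable 0 a)
        ((hE ζ).intervalIntegrable a b)]
    congr 1
    ring
  have ht2 : 0 < t / 2 := by linarith
  have hcont : ∀ s ∈ Set.Ioi (0 : ℝ), ContinuousAt y s := fun s hs =>
    hyc.continuousAt (Ioi_mem_nhds hs)
  have h := (intervalIntegral.integral_hasDerivAt_right (hyi (t / 2) t ht2 (by linarith))
    (ContinuousAt.stronglyMeasurableAtFilter isOpen_Ioi hcont t ht) (hcont t ht)).const_sub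
      (G (t / 2))
  refine h.congr_of_eventuallyEq ?_
  filter_upwards [lt_mem_nhds (show t / 2 < t by linarith)] with r hr
  exact hdiff _ _ ht2 hr.le

/-- Existence for a nonnegative diagonal operator with its maximal domain. -/
lemma exists_isHeatSolution [CompleteSpace X] {γ : ι → ℝ} (hγ : ∀ ζ, 0 ≤ γ ζ) (A : X →ₗ.[𝕜] X)
    (hdom : ∀ x y : X, (∀ ζ, Φ y ζ = (γ ζ : 𝕜) * Φ x ζ) → x ∈ A.domain)
    (hA : ∀ (x : A.domain) (ζ : ι), Φ (A x) ζ = (γ ζ : 𝕜) * Φ x ζ)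
    {β : ℝ} (hβ : 0 < β) (hβ1 : β ≤ 1) (x₀ : X) :
    ∃ w : ℝ → X, IsHeatSolution A β x₀ w ∧
      ∀ t, 0 ≤ t → ∀ ζ, Φ (w t) ζ = (mittagLeffler β 1 (-γ ζ * t ^ β) : ℝ) * Φ x₀ ζ := by
  -- Only times `t ≥ 0` matter; `0` is a dummy value elsewhere. The same device gives `y`, which
  -- represents `A w`, for `t > 0`.
  have hex : ∀ t : ℝ, ∃ x : X, 0 ≤ t → ∀ ζ,
      Φ x ζ = (mittagLeffler β 1 (-γ ζ * t ^ β) : ℝ) * Φ x₀ ζ := fun t => by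
    by_cases ht : 0 ≤ t
    · obtain ⟨d, hd, -⟩ := exists_lp_two_mul
        (fun ζ => abs_mittagLeffler_neg_le_one hβ hβ1 (hγ ζ) ht) (Φ x₀)
      exact ⟨Φ.symm d, fun _ => by simpa using hd⟩
    · exact ⟨0, fun h => absurd h ht⟩
  have hex' : ∀ t : ℝ, ∃ y : X, 0 < t → ∀ ζ,
      Φ y ζ = ((γ ζ * mittagLeffler β 1 (-γ ζ * t ^ β) : ℝ) : 𝕜) * Φ x₀ ζ := fun t => by
    by_cases ht : 0 < t
    · obtain ⟨d, hd, -⟩ := exists_lp_two_mul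
        (fun ζ => abs_mul_mittagLeffler_neg_le hβ hβ1 (hγ ζ) ht) (Φ x₀)
      exact ⟨Φ.symm d, fun _ => by simpa using hd⟩
    · exact ⟨0, fun h => absurd h ht⟩
  choose w hw using hex
  choose y hy using hex'
  refine ⟨w, ⟨continuousOn_of_coord_mittagLeffler Φ hγ hβ hβ1 hw, ?_, fun t ht => ?_⟩, hw⟩
  · refine Φ.injective (lp.ext (funext fun ζ => ?_))
    rw [hw 0 le_rfl, mittagLeffler_neg_mul_zero_rpow hβ]
    simp
  · have hyw : ∀ ζ, Φ (y t) ζ = (γ ζ : 𝕜) * Φ (w t) ζ := fun ζ => by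
      rw [hy t ht, hw t ht.le, RCLike.ofReal_mul, mul_assoc]
    have hd := hdom (w t) (y t) hyw
    refine ⟨hd, ?_⟩
    let _ : NormedSpace ℝ X := NormedSpace.restrictScalars ℝ 𝕜 X
    have _ : IsScalarTower ℝ 𝕜 X := RestrictScalars.isScalarTower ℝ 𝕜 X
    have hAy : A ⟨w t, hd⟩ = y t := Φ.injective (lp.ext (funext fun ζ => by rw [hA, hyw]))
    rw [hAy]
    exact hasCaputoDerivAt_of_coord Φ hγ hβ hβ1 hw hy ht

end Diagonal

/-! ### The Sobolev scale and the heat equation -/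

namespace PositiveDiscreteOperator

variable {𝕜 H ι : Type*} [RCLike 𝕜] [NormedAddCommGroup H] [InnerProductSpace 𝕜 H]
variable (S : PositiveDiscreteOperator 𝕜 H ι)

lemma one_add_gamma_ne_zero (ζ : ι) : (1 + (S.γ ζ : 𝕜)) ≠ 0 := by
  have h := (S.one_add_gamma_pos ζ).ne'
  exact_mod_cast h

/-- `L` has its maximal domain. -/
lemma mem_domain_of_repr (x y : H) (h : ∀ ζ, S.e.repr y ζ = (S.γ ζ : 𝕜) * S.e.repr x ζ) :
    x ∈ S.L.domain := by
  have hres : (-1 : 𝕜) ∉ unboundedSpectrum S.L := by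
    rw [S.spectrum_eq]
    rintro ⟨η, hη⟩
    have h1 : ((S.γ η : ℝ) : 𝕜) = ((-1 : ℝ) : 𝕜) := by simpa using hη
    have h2 : S.γ η = -1 := by exact_mod_cast h1
    have := S.gamma_nonneg η
    linarith
  obtain ⟨R, hR, -⟩ := not_not.1 hres
  -- Here `y` is the candidate for `L x`. Dividing `(L + 1) R (y + x) = y + x` by `1 + γ` in each
  -- coordinate gives `R (y + x) = x`, and the range of `R` lies in the domain.
  obtain ⟨hd, hx⟩ := hR (y + x)
  have hxx : R (y + x) = x := by
    refine S.e.repr.injective (lp.ext (funext fun ζ => ?_))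
    have h1 := congrArg (fun z => inner 𝕜 (S.e ζ) z) hx
    simp only [neg_smul, one_smul, sub_neg_eq_add, inner_add_right, S.inner_e_apply] at h1
    simp only [← S.e.repr_apply_apply, h] at h1
    refine mul_left_cancel₀ (S.one_add_gamma_ne_zero ζ) ?_
    linear_combination h1
  rwa [hxx] at hd

lemma coeff_genOp (ζ : ι) (u : S.GenVec) :
    S.coeff ζ (S.genOp u) = (S.γ ζ : 𝕜) * S.coeff ζ u := by
  change u.1 (S.testOp (S.eTest ζ)) = (S.γ ζ : 𝕜) * u.1 (S.eTest ζ)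
  rw [testOp_eTest, map_smulₛₗ]
  simp

lemma coeff_one_add_genOp_pow (k : ℕ) (ζ : ι) (u : S.GenVec) :
    S.coeff ζ (((1 + S.genOp) ^ k) u) = (1 + (S.γ ζ : 𝕜)) ^ k * S.coeff ζ u := by
  induction k with
  | zero => simp
  | succ k ih =>
    rw [pow_succ', Module.End.mul_apply, LinearMap.add_apply, Module.End.one_apply, map_add,
      coeff_genOp, ih]
    ring

lemma genVec_eq {u v : S.GenVec} (h : ∀ ζ, S.coeff ζ u = S.coeff ζ v) : u = v :=
  sub_eq_zero.1 (S.genVec_ext fun ζ => by rw [map_sub, h, sub_self])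

lemma weight_pos (δ : ℝ) (ζ : ι) : (0 : ℝ) < (1 + S.γ ζ) ^ (δ / 2) :=
  Real.rpow_pos_of_pos (S.one_add_gamma_pos ζ) _

lemma weight_ne_zero (δ : ℝ) (ζ : ι) : (((1 + S.γ ζ) ^ (δ / 2) : ℝ) : 𝕜) ≠ 0 := by
  exact_mod_cast (S.weight_pos δ ζ).ne'

/-- The required coefficients `(1 + γ)^(-δ/2) a` may not be square summable. For an integer `k ≥
-δ/2`, dividing them by `(1 + γ)^k` gives a vector of `H`, and `(1 + L)^k` applied to it by duality
is a generalised vector. -/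
lemma sobolevToL2_surjective (δ : ℝ) : Function.Surjective (S.sobolevToL2 δ) := by
  intro a
  obtain ⟨k, hk⟩ := exists_nat_ge (-(δ / 2))
  obtain ⟨d, hd, -⟩ := exists_lp_two_mul (m := fun ζ => (1 + S.γ ζ) ^ (-(δ / 2) - k)) (K := 1)
    (fun ζ => by
      have h1 : 1 ≤ 1 + S.γ ζ := by linarith [S.gamma_nonneg ζ]
      rw [abs_of_pos (Real.rpow_pos_of_pos (S.one_add_gamma_pos ζ) _)]
      exact Real.rpow_le_one_of_one_le_of_nonpos h1 (by linarith)) a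
  set u : S.GenVec := ((1 + S.genOp) ^ k) (S.ofVec (S.e.repr.symm d)) with hu
  have hcu : S.weightedCoeff δ u = a := by
    funext ζ
    have h1 : S.coeff ζ (S.ofVec (S.e.repr.symm d)) = d ζ := by
      have h2 := S.e.repr_apply_apply (S.e.repr.symm d) ζ
      rw [LinearIsometryEquiv.apply_symm_apply] at h2
      exact h2.symm
    rw [weightedCoeff, hu, coeff_one_add_genOp_pow, h1, hd, ← mul_assoc, ← mul_assoc]
    have h3 : (1 + S.γ ζ) ^ (δ / 2) * (1 + S.γ ζ) ^ k * (1 + S.γ ζ) ^ (-(δ / 2) - k) = 1 := by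
      rw [← Real.rpow_natCast, ← Real.rpow_add (S.one_add_gamma_pos ζ),
        ← Real.rpow_add (S.one_add_gamma_pos ζ)]
      simp
    have h4 : (((1 + S.γ ζ) ^ (δ / 2) : ℝ) : 𝕜) * (1 + (S.γ ζ : 𝕜)) ^ k *
        (((1 + S.γ ζ) ^ (-(δ / 2) - k) : ℝ) : 𝕜) = 1 := by exact_mod_cast h3
    rw [h4, one_mul]
  refine ⟨⟨u, ?_⟩, Subtype.ext hcu⟩
  change Memℓp (S.weightedCoeff δ u) 2
  rw [hcu]
  exact lp.memℓp a

/-- The isometric isomorphism `u ↦ (1 + L)^(δ/2) u` from `H^δ` onto `ℓ²`. -/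
def sobolevIso (δ : ℝ) : S.sobolev δ ≃ₗᵢ[𝕜] lp (fun _ : ι => 𝕜) 2 :=
  LinearIsometryEquiv.ofSurjective ⟨S.sobolevToL2 δ, fun _ => rfl⟩ (S.sobolevToL2_surjective δ)

lemma sobolevIso_apply (δ : ℝ) (u : S.sobolev δ) (ζ : ι) :
    S.sobolevIso δ u ζ = (((1 + S.γ ζ) ^ (δ / 2) : ℝ) : 𝕜) * S.coeff ζ (u : S.GenVec) := rfl

instance sobolevCompleteSpace (δ : ℝ) : CompleteSpace (S.sobolev δ) :=
  ((S.sobolevIso δ).isometry.isUniformInducing.completeSpace_congr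
    (S.sobolevIso δ).surjective).2 inferInstance

lemma hasSum_coeff_smul_eSobolev (δ : ℝ) (u : S.sobolev δ) :
    HasSum (fun ζ => S.coeff ζ (u : S.GenVec) • S.eSobolev δ ζ) u := by
  classical
  have h := lp.hasSum_single (p := 2) ENNReal.ofNat_ne_top (S.sobolevIso δ u)
  have h1 := (S.sobolevIso δ).symm.toContinuousLinearEquiv.toContinuousLinearMap.hasSum h
  have h2 : (S.sobolevIso δ).symm (S.sobolevIso δ u) = u := (S.sobolevIso δ).symm_apply_apply u
  have h3 : HasSum (fun ζ => (S.sobolevIso δ).symm (lp.single 2 ζ (S.sobolevIso δ u ζ))) u := by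
    have h4 : HasSum (fun ζ => (S.sobolevIso δ).symm (lp.single 2 ζ (S.sobolevIso δ u ζ)))
      ((S.sobolevIso δ).symm (S.sobolevIso δ u)) := h1
    rwa [h2] at h4
  refine h3.congr_fun fun ζ => ?_
  refine (S.sobolevIso δ).injective (lp.ext (funext fun η => ?_))
  rw [LinearIsometryEquiv.apply_symm_apply, map_smul, lp.coeFn_smul, Pi.smul_apply,
    sobolevIso_apply, smul_eq_mul]
  change _ * (_ * S.coeff η (S.ofVec (S.e ζ))) = _
  rw [coeff_ofVec_e]
  by_cases hη : η = ζ
  · subst hη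
    simp [S.e.orthonormal.1 η, sobolevIso_apply, mul_comm]
  · rw [S.e.orthonormal.2 hη, lp.single_apply_ne _ _ _ hη]
    simp

lemma sobolevOp_apply (δ : ℝ) (u : (S.sobolevOp δ).domain) :
    ((S.sobolevOp δ u : S.sobolev δ) : S.GenVec) = S.genOp ((u : S.sobolev δ) : S.GenVec) := rfl

lemma sobolevIso_sobolevOp (δ : ℝ) (u : (S.sobolevOp δ).domain) (ζ : ι) :
    S.sobolevIso δ (S.sobolevOp δ u) ζ = (S.γ ζ : 𝕜) * S.sobolevIso δ u ζ := by
  rw [sobolevIso_apply, sobolevOp_apply, coeff_genOp, sobolevIso_apply]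
  ring

lemma mem_sobolevOp_domain (δ : ℝ) (x y : S.sobolev δ)
    (h : ∀ ζ, S.sobolevIso δ y ζ = (S.γ ζ : 𝕜) * S.sobolevIso δ x ζ) :
    x ∈ (S.sobolevOp δ).domain := by
  change S.genOp (x : S.GenVec) ∈ S.sobolev δ
  have h1 : S.genOp (x : S.GenVec) = y := S.genVec_eq fun ζ => by
    have h2 := h ζ
    rw [sobolevIso_apply, sobolevIso_apply] at h2
    refine mul_left_cancel₀ (S.weight_ne_zero δ ζ) ?_
    rw [coeff_genOp, h2]
    ring
  rw [h1]
  exact y.2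

/-- In `ℓ²` coordinates the multiplier picks up the ratio of the two weights: `1` for `δ' = δ`, and
`1 + γ` for `δ' = δ - 2`. -/
lemma exists_sobolev_mul {δ δ' : ℝ} {m : ι → ℝ} {K : ℝ}
    (hm : ∀ ζ, |(1 + S.γ ζ) ^ ((δ - δ') / 2) * m ζ| ≤ K) (u : S.sobolev δ') :
    ∃ v : S.sobolev δ, (∀ ζ, S.coeff ζ (v : S.GenVec) = (m ζ : 𝕜) * S.coeff ζ (u : S.GenVec)) ∧
      ‖v‖ ≤ |K| * ‖u‖ := by
  obtain ⟨d, hd, hn⟩ := exists_lp_two_mul hm (S.sobolevIso δ' u)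
  refine ⟨(S.sobolevIso δ).symm d, fun ζ => ?_, by simpa using hn⟩
  have h1 := S.sobolevIso_apply δ ((S.sobolevIso δ).symm d) ζ
  rw [LinearIsometryEquiv.apply_symm_apply, hd, sobolevIso_apply] at h1
  refine mul_left_cancel₀ (S.weight_ne_zero δ ζ) ?_
  have h2 : (1 + S.γ ζ) ^ ((δ - δ') / 2) * (1 + S.γ ζ) ^ (δ' / 2) = (1 + S.γ ζ) ^ (δ / 2) := by
    rw [← Real.rpow_add (S.one_add_gamma_pos ζ)]
    congr 1
    ring
  rw [← h1, ← h2]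
  push_cast
  ring

lemma exists_isUniqueSolution {β : ℝ} (hβ : 0 < β) (hβ1 : β ≤ 1) (δ : ℝ) (w₀ : S.sobolev δ) :
    ∃ w : ℝ → S.sobolev δ, S.IsUniqueSolution δ β w₀ w ∧ ∀ t, 0 ≤ t → ∀ ζ,
      S.coeff ζ (w t : S.GenVec)
        = (mittagLeffler β 1 (-S.γ ζ * t ^ β) : ℝ) * S.coeff ζ (w₀ : S.GenVec) := by
  have hcancel : ∀ (σ : ℝ) (x y : S.sobolev σ) (c : 𝕜) (ζ : ι),
      S.sobolevIso σ x ζ = c * S.sobolevIso σ y ζ →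
        S.coeff ζ (x : S.GenVec) = c * S.coeff ζ (y : S.GenVec) := fun σ x y c ζ h => by
    rw [sobolevIso_apply, sobolevIso_apply] at h
    refine mul_left_cancel₀ (S.weight_ne_zero σ ζ) ?_
    rw [h]
    ring
  obtain ⟨w, hw, hwc⟩ := exists_isHeatSolution (S.sobolevIso δ) S.gamma_nonneg (S.sobolevOp δ)
    (S.mem_sobolevOp_domain δ) (S.sobolevIso_sobolevOp δ) hβ hβ1 w₀
  have hc := fun t ht ζ => hcancel δ _ _ _ ζ (hwc t ht ζ)
  refine ⟨w, ⟨hw, fun t ht => ?_, fun σ v₀ v hv₀ hv t ht => ?_⟩, hc⟩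
  · refine (S.hasSum_coeff_smul_eSobolev δ (w t)).congr_fun fun ζ => ?_
    rw [hc t ht, mul_comm]
  -- The coefficients of a solution in `H^σ` are given by a formula independent of `σ`, so
  -- comparison across the scale takes place in `GenVec`.
  · refine S.genVec_eq fun ζ => ?_
    have h1 := hv.coord_eq hβ hβ1 (l2Coord (S.sobolevIso σ) ζ) (S.γ ζ)
      (fun x => S.sobolevIso_sobolevOp σ x ζ) ht
    rw [hcancel σ _ _ _ ζ h1, hc t ht, hv₀]

lemma exists_isUniqueSolution_norm_le {β : ℝ} (hβ : 0 < β) (hβ1 : β ≤ 1) (δ : ℝ) {K : ℝ → ℝ}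
    (hK : ∀ t, 0 ≤ t → ∀ ζ, mittagLeffler β 1 (-S.γ ζ * t ^ β) ≤ K t)
    (hK0 : ∀ t, 0 ≤ t → 0 ≤ K t) (w₀ : S.sobolev δ) :
    ∃ w : ℝ → S.sobolev δ, S.IsUniqueSolution δ β w₀ w ∧ ∀ t, 0 ≤ t → ‖w t‖ ≤ K t * ‖w₀‖ := by
  obtain ⟨w, hw, hc⟩ := S.exists_isUniqueSolution hβ hβ1 δ w₀
  refine ⟨w, hw, fun t ht => ?_⟩
  obtain ⟨v, hv, hn⟩ := S.exists_sobolev_mul (δ := δ) (δ' := δ)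
    (m := fun ζ => mittagLeffler β 1 (-S.γ ζ * t ^ β)) (K := K t) (fun ζ => by
      have h0 : 0 ≤ mittagLeffler β 1 (-S.γ ζ * t ^ β) := by
        rw [neg_mul]
        exact mittagLeffler_neg_nonneg hβ hβ1
          (mul_nonneg (S.gamma_nonneg ζ) (Real.rpow_nonneg ht _))
      rw [sub_self, zero_div, Real.rpow_zero, one_mul, abs_of_nonneg h0]
      exact hK t ht ζ) w₀
  have hwv : w t = v := Subtype.ext (S.genVec_eq fun ζ => by rw [hc t ht, hv])
  rw [hwv]
  rwa [abs_of_nonneg (hK0 t ht)] at hn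

/-- The spectral gap: `R (γ e) = e` for the bounded inverse `R` of `L`, so `1 ≤ ‖R‖ γ`. -/
lemma exists_one_le_mul_gamma (h : (0 : 𝕜) ∉ unboundedSpectrum S.L) :
    ∃ M : ℝ, 0 ≤ M ∧ ∀ ζ, 1 ≤ M * S.γ ζ := by
  obtain ⟨R, -, hR⟩ := not_not.1 h
  refine ⟨‖R‖, norm_nonneg R, fun ζ => ?_⟩
  have h1 := hR ⟨S.e ζ, S.e_mem ζ⟩
  rw [zero_smul, sub_zero, S.eigen] at h1
  have h2 := R.le_opNorm ((S.γ ζ : 𝕜) • S.e ζ)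
  rwa [h1, norm_smul, RCLike.norm_ofReal, abs_of_nonneg (S.gamma_nonneg ζ), S.e.orthonormal.1 ζ,
    mul_one] at h2

lemma hasSum_mittagLeffler_testOp {β : ℝ} (hβ : 0 < β) (t : ℝ) (ζ : ι) :
    HasSum (fun k : ℕ => (((-t ^ β) ^ k / Real.Gamma (β * k + 1) : ℝ) : 𝕜) •
        (((S.testOp ^ k) (S.eTest ζ) : S.testSpace) : H))
      (((mittagLeffler β 1 (-S.γ ζ * t ^ β) : ℝ) : 𝕜) • S.e ζ) := by
  have h := (summable_mittagLeffler hβ one_pos (-S.γ ζ * t ^ β)).hasSum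
  have h1 := ((RCLike.ofRealCLM (K := 𝕜)).hasSum h).smul_const (S.e ζ)
  refine h1.congr_fun fun k => ?_
  rw [testOp_pow_eTest]
  change _ • ((S.γ ζ : 𝕜) ^ k • S.e ζ) = _
  rw [smul_smul]
  congr 1
  rw [RCLike.ofRealCLM_apply, ← RCLike.ofReal_pow, ← RCLike.ofReal_mul]
  congr 1
  rw [neg_mul, ← mul_neg, mul_pow]
  ring

lemma exists_heatSolution [CompleteSpace H] {β : ℝ} (hβ : 0 < β) (hβ1 : β ≤ 1) (w₀ : H) :
    ∃ w : ℝ → H, IsHeatSolution S.L β w₀ w ∧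
      (∀ t : ℝ, 0 ≤ t → HasSum
        (fun ζ => (inner 𝕜 (S.e ζ) w₀ * ((mittagLeffler β 1 (-S.γ ζ * t ^ β) : ℝ) : 𝕜)) • S.e ζ)
        (w t)) ∧
      ∀ v : ℝ → H, IsHeatSolution S.L β w₀ v → ∀ t : ℝ, 0 ≤ t → v t = w t := by
  have hA : ∀ (x : S.L.domain) (ζ : ι), S.e.repr (S.L x) ζ = (S.γ ζ : 𝕜) * S.e.repr x ζ :=
    fun x ζ => by
      rw [S.e.repr_apply_apply, S.e.repr_apply_apply, S.inner_e_apply]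
  obtain ⟨w, hw, hc⟩ := exists_isHeatSolution S.e.repr S.gamma_nonneg S.L S.mem_domain_of_repr hA
    hβ hβ1 w₀
  refine ⟨w, hw, fun t ht => ?_, fun v hv t ht => ?_⟩
  · refine (S.e.hasSum_repr (w t)).congr_fun fun ζ => ?_
    rw [hc t ht, S.e.repr_apply_apply, mul_comm]
  · refine l2Coord_ext S.e.repr fun ζ => ?_
    have h1 := hv.coord_eq hβ hβ1 (l2Coord S.e.repr ζ) (S.γ ζ) (fun x => hA x ζ) ht
    exact h1.trans (hc t ht ζ).symm

lemma exists_isUniqueSolution_smoothing {β : ℝ} (hβ : 0 < β) (hβ1 : β ≤ 1) (δ : ℝ)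
    (w₀ : S.sobolev (δ - 2)) :
    ∃ w : ℝ → S.sobolev (δ - 2), S.IsUniqueSolution (δ - 2) β w₀ w ∧
      ∃ v : ℝ → S.sobolev δ, ContinuousOn v (Set.Ioi 0) ∧
        ∀ t : ℝ, 0 < t → (v t : S.GenVec) = w t ∧
          HasSum (fun ζ => (S.coeff ζ (w₀ : S.GenVec) *
            ((mittagLeffler β 1 (-S.γ ζ * t ^ β) : ℝ) : 𝕜)) • S.eSobolev δ ζ) (v t) ∧
          ‖v t‖ ≤ (1 + Real.Gamma (β + 1) * t ^ (-β)) * ‖w₀‖ := by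
  obtain ⟨w, hw, hc⟩ := S.exists_isUniqueSolution hβ hβ1 (δ - 2) w₀
  have hG := Real.Gamma_pos_of_pos (s := β + 1) (by linarith)
  have hex : ∀ t : ℝ, ∃ v : S.sobolev δ, 0 < t →
      (∀ ζ, S.coeff ζ (v : S.GenVec)
        = (mittagLeffler β 1 (-S.γ ζ * t ^ β) : ℝ) * S.coeff ζ (w₀ : S.GenVec)) ∧
      ‖v‖ ≤ (1 + Real.Gamma (β + 1) * t ^ (-β)) * ‖w₀‖ := fun t => by
    by_cases ht : 0 < t
    · obtain ⟨v, hv, hn⟩ := S.exists_sobolev_mul (δ := δ) (δ' := δ - 2)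
        (m := fun ζ => mittagLeffler β 1 (-S.γ ζ * t ^ β))
        (K := 1 + Real.Gamma (β + 1) * t ^ (-β)) (fun ζ => by
          simpa using abs_add_mul_mittagLeffler_neg_le hβ hβ1 (S.gamma_nonneg ζ) ht 1) w₀
      refine ⟨v, fun _ => ⟨hv, ?_⟩⟩
      have := Real.rpow_nonneg ht.le (-β)
      rwa [abs_of_nonneg (by positivity)] at hn
    · exact ⟨0, fun h => absurd h ht⟩
  choose v hv using hex
  refine ⟨w, hw, v, ?_, fun t ht => ⟨?_, ?_, (hv t ht).2⟩⟩
  -- Continuity is tested against the element of `H^δ` with the same `ℓ²` coordinates as `w₀` in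
  -- `H^(δ-2)`; the quotient of the weights then supplies the factor `1 + γ`.
  · refine continuousOn_of_coord_mul_mittagLeffler (S.sobolevIso δ) S.gamma_nonneg hβ hβ1 1
      (x₀ := (S.sobolevIso δ).symm (S.sobolevIso (δ - 2) w₀)) fun t ht ζ => ?_
    rw [LinearIsometryEquiv.apply_symm_apply, sobolevIso_apply, sobolevIso_apply, (hv t ht).1]
    have h1 : (1 + S.γ ζ) ^ (δ / 2) = (1 + S.γ ζ) * (1 + S.γ ζ) ^ ((δ - 2) / 2) := by
      nth_rewrite 2 [← Real.rpow_one (1 + S.γ ζ)]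
      rw [← Real.rpow_add (S.one_add_gamma_pos ζ)]
      congr 1
      ring
    rw [h1]
    push_cast
    ring
  · exact S.genVec_eq fun ζ => by rw [(hv t ht).1, hc t ht.le]
  · refine (S.hasSum_coeff_smul_eSobolev δ (v t)).congr_fun fun ζ => ?_
    rw [(hv t ht).1, mul_comm]

end PositiveDiscreteOperator

end

theorem mainTheorem1 {𝕜 H ι : Type*} [RCLike 𝕜] [NormedAddCommGroup H] [InnerProductSpace 𝕜 H]
    [CompleteSpace H] [TopologicalSpace.SeparableSpace H]
    (S : PositiveDiscreteOperator 𝕜 H ι) (β : ℝ) (hβ0 : 0 < β) (hβ1 : β ≤ 1) (δ : ℝ) :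
    -- the propagator `E_β(-t^β L)` acts on the eigenvectors as multiplication by `E_β(-γ t^β)`
    (∀ t : ℝ, 0 ≤ t → ∀ ζ : ι, HasSum
      (fun k : ℕ => (((-t ^ β) ^ k / Real.Gamma (β * k + 1) : ℝ) : 𝕜) •
        (((S.testOp ^ k) (S.eTest ζ) : S.testSpace) : H))
      (((mittagLeffler β 1 (-S.γ ζ * t ^ β) : ℝ) : 𝕜) • S.e ζ)) ∧
    -- well-posedness in `H`
    (∀ w₀ : H, ∃ w : ℝ → H, IsHeatSolution S.L β w₀ w ∧
      (∀ t : ℝ, 0 ≤ t → HasSum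
        (fun ζ => (inner 𝕜 (S.e ζ) w₀ * ((mittagLeffler β 1 (-S.γ ζ * t ^ β) : ℝ) : 𝕜)) • S.e ζ)
        (w t)) ∧
      ∀ v : ℝ → H, IsHeatSolution S.L β w₀ v → ∀ t : ℝ, 0 ≤ t → v t = w t) ∧
    -- the solution and its bound in `H^δ`
    (∃ C : ℝ, 0 < C ∧ ∀ w₀ : S.sobolev δ, ∃ w : ℝ → S.sobolev δ, S.IsUniqueSolution δ β w₀ w ∧
      ∀ t : ℝ, 0 ≤ t → ‖w t‖ ≤ C * ‖w₀‖) ∧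
    -- the improved bound when `0` is not in the spectrum
    ((0 : 𝕜) ∉ unboundedSpectrum S.L →
      ∃ C : ℝ, 0 < C ∧ ∀ w₀ : S.sobolev δ, ∃ w : ℝ → S.sobolev δ, S.IsUniqueSolution δ β w₀ w ∧
        ∀ t : ℝ, 0 ≤ t → ‖w t‖ ≤ C * (1 + t ^ β)⁻¹ * ‖w₀‖) ∧
    -- initial data in `H^(δ-2)`: the solution lies in `H^δ` for positive times
    (∃ C : ℝ, 0 < C ∧ ∀ w₀ : S.sobolev (δ - 2), ∃ w : ℝ → S.sobolev (δ - 2),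
      S.IsUniqueSolution (δ - 2) β w₀ w ∧
      ∃ v : ℝ → S.sobolev δ, ContinuousOn v (Set.Ioi 0) ∧
        ∀ t : ℝ, 0 < t → (v t : S.GenVec) = w t ∧
          HasSum (fun ζ => (S.coeff ζ (w₀ : S.GenVec) *
            ((mittagLeffler β 1 (-S.γ ζ * t ^ β) : ℝ) : 𝕜)) • S.eSobolev δ ζ) (v t) ∧
          ‖v t‖ ≤ C * (1 + t ^ (-β)) * ‖w₀‖) := by
  refine ⟨fun t _ ζ => S.hasSum_mittagLeffler_testOp hβ0 t ζ, S.exists_heatSolution hβ0 hβ1,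
    ⟨1, one_pos, fun w₀ => ?_⟩, fun h0 => ?_, ?_⟩
  · refine S.exists_isUniqueSolution_norm_le hβ0 hβ1 δ (K := fun _ => 1) (fun t ht ζ => ?_)
      (fun _ _ => zero_le_one) w₀
    exact (le_abs_self _).trans (abs_mittagLeffler_neg_le_one hβ0 hβ1 (S.gamma_nonneg ζ) ht)
  · obtain ⟨M, hM, hMγ⟩ := S.exists_one_le_mul_gamma h0
    have hG := Real.Gamma_pos_of_pos (s := β + 1) (by linarith)
    have hC : 0 < 1 + M * Real.Gamma (β + 1) := by positivity
    refine ⟨1 + M * Real.Gamma (β + 1), hC, fun w₀ => ?_⟩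
    refine S.exists_isUniqueSolution_norm_le hβ0 hβ1 δ
      (K := fun t => (1 + M * Real.Gamma (β + 1)) * (1 + t ^ β)⁻¹) (fun t ht ζ => ?_)
      (fun t ht => mul_nonneg hC.le (inv_nonneg.2 (by linarith [Real.rpow_nonneg ht β]))) w₀
    have htβ : 0 ≤ t ^ β := Real.rpow_nonneg ht _
    have hx : 0 ≤ S.γ ζ * t ^ β := mul_nonneg (S.gamma_nonneg ζ) htβ
    have h1 := mittagLeffler_neg_mul_le_one hβ0 hβ1 hx
    have h2 := mittagLeffler_neg_nonneg hβ0 hβ1 hx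
    rw [neg_mul, ← div_eq_mul_inv, le_div_iff₀ (by linarith)]
    -- In the expanded product the cross term is `M γ t^β ≥ t^β`, which is where the spectral gap
    -- enters and fixes the constant.
    have h3 : 1 + t ^ β
        ≤ (1 + M * Real.Gamma (β + 1)) * (1 + S.γ ζ * t ^ β / Real.Gamma (β + 1)) := by
      have h4 : (1 + M * Real.Gamma (β + 1)) * (1 + S.γ ζ * t ^ β / Real.Gamma (β + 1))
          = 1 + M * Real.Gamma (β + 1) + S.γ ζ * t ^ β / Real.Gamma (β + 1)
            + M * S.γ ζ * t ^ β := by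
        field_simp
        ring
      have h5 : t ^ β ≤ M * S.γ ζ * t ^ β := le_mul_of_one_le_left htβ (hMγ ζ)
      have h6 : 0 ≤ M * Real.Gamma (β + 1) := by positivity
      have h7 : 0 ≤ S.γ ζ * t ^ β / Real.Gamma (β + 1) := by positivity
      linarith
    calc mittagLeffler β 1 (-(S.γ ζ * t ^ β)) * (1 + t ^ β)
        ≤ mittagLeffler β 1 (-(S.γ ζ * t ^ β)) *
          ((1 + M * Real.Gamma (β + 1)) * (1 + S.γ ζ * t ^ β / Real.Gamma (β + 1))) := by gcongr
      _ = (1 + M * Real.Gamma (β + 1)) * (mittagLeffler β 1 (-(S.γ ζ * t ^ β)) *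
          (1 + S.γ ζ * t ^ β / Real.Gamma (β + 1))) := by ring
      _ ≤ (1 + M * Real.Gamma (β + 1)) * 1 := by gcongr
      _ = _ := mul_one _
  · have hG := Real.Gamma_pos_of_pos (s := β + 1) (by linarith)
    -- The constant comes from `1 + Γ(β+1) s ≤ (1 + Γ(β+1)) (1 + s)` with `s = t^(-β)`.
    refine ⟨1 + Real.Gamma (β + 1), by positivity, fun w₀ => ?_⟩
    obtain ⟨w, hw, v, hvc, hv⟩ := S.exists_isUniqueSolution_smoothing hβ0 hβ1 δ w₀
    refine ⟨w, hw, v, hvc, fun t ht => ⟨(hv t ht).1, (hv t ht).2.1, (hv t ht).2.2.trans ?_⟩⟩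
    have := Real.rpow_nonneg ht.le (-β)
    refine mul_le_mul_of_nonneg_right ?_ (norm_nonneg _)
    nlinarith
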